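/- For $n\ge 1$ and a set $C\subseteq\mathbb Z_n\setminus\{0\}$ put $\overline C=\{c\in C: -c\notin C\}$. The mixed circulant graph $G(\mathbb Z_n,C)$ has vertex set $\mathbb Z_n$, an undirected edge $\{a,b\}$ whenever $b-a\in C\setminus\overline C$, and an arc $(a,b)$ whenever $b-a\in\overline C$. The Hermitian adjacency matrix $H_\Gamma=(h_{uv})$ of a mixed graph $\Gamma$ has $h_{uv}=1$ if $\{u,v\}$ is an edge, $h_{uv}=\mathrm i$ if $(u,v)$ is an arc, $h_{uv}=-\mathrm i$ if $(v,u)$ is an arc, and $h_{uv}=0$ otherwise. $\Gamma$ has perfect state transfer (PST) between $u$ and $v$ if $\exp(\mathrm i tH_\Gamma)\mathbf e_u=\gamma\mathbf e_v$ for some $t\in\mathbb R$ and some $\gamma\in\mathbb C$ with $|\gamma|=1$ (this is symmetric in $u$ and $v$). For $d\mid n$ let $G_n(d)=\{1\le k\le n-1:\gcd(k,n)=d\}$ and $G_n^{\pm1}(d)=\{k\in G_n(d): k/d\equiv\pm1 \pmod 4\}$. Let $B\subseteq\{d: d\mid n,\ 1\le d<n\}$, let $D\subseteq\{d\ge 1: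 4d\mid n\}$ (so $D=\emptyset$ if $4\nmid n$) with $B\cap D=\emptyset$, and let $\sigma:D\to\{1,-1\}$. The integral mixed circulant graph $\mathrm{IMCG}_n(B,D,\sigma)$ is $G(\mathbb Z_n,C)$ with $C=\bigcup_{d\in B}G_n(d)\cup\bigcup_{d\in D}G_n^{\sigma(d)}(d)$. For $i\ge 0$ let $B_i$ (resp. $D_i$) be the set of $d\in B$ (resp. $d\in D$) for which $2^i$ is the exact power of $2$ dividing $n/d$. For $i\in\{1,2,3\}$ let $B^*_i=B_i\setminus\{n/2^i\}$. For an integer $k$ and a set $A$ of integers write $kA=\{ka:a\in A\}$. **Theorem.** Let $\Gamma=\mathrm{IMCG}_n(B,D,\sigma)$, and assume that it is not the case that both $n\equiv 2\pmod 4$ and $B=\{n/2\}$ (i.e. $\Gamma$ is not a disjoint union of an odd number of copies of $K_2$). Then $n$ is even and $\Gamma$ has PST between $b+n/2$ and $b$ for every $b\in\mathbb Z_n$ if and only if $B_0=2B^*_1=4B^*_2$ and one of the following holds: (i) $n\equiv0\pmod 4$, $D_2=\{n/4\}$ and $n/2\notin B$; (ii) $n\equiv0\pmod 4$, $D_2=\emptyset$,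 and exactly one of $n/2$ and $n/4$ belongs to $B$; (iii) $n\equiv0\pmod 8$, $D_2=\emptyset$, $\{n/4,n/2\}\subseteq B$, $D_3=\{n/8\}$ and $B^*_2=2B^*_3$. -/

import Mathlib

/-- A (simple) mixed graph: symmetric irreflexive undirected edges and directed arcs; between two
vertices there is at most one of: an undirected edge, an arc one way, an arc the other way. -/
structure MixedGraph (V : Type*) where
  /-- `edge u v`: `{u, v}` is an undirected edge. -/
  edge : V → V → Prop
  /-- `arc u v`: `(u, v)` is a directed edge. -/
  arc : V → V → Prop
  edge_symm : ∀ u v, edge u v → edge v u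
  edge_irrefl : ∀ u, ¬ edge u u
  arc_asymm : ∀ u v, arc u v → ¬ arc v u
  edge_not_arc : ∀ u v, edge u v → ¬ arc u v

namespace MixedGraph

variable {V : Type*}

open Classical in
/-- The Hermitian adjacency matrix. -/
noncomputable def hermitianAdj (Γ : MixedGraph V) : Matrix V V ℂ :=
  Matrix.of fun u v =>
    if Γ.edge u v then 1
    else if Γ.arc u v then Complex.I
    else if Γ.arc v u then -Complex.I
    else 0

/-- The transition matrix `U(t) = exp(i t H)`. -/
noncomputable def transition [Fintype V] [DecidableEq V] (Γ : MixedGraph V) (t : ℝ) :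
    Matrix V V ℂ :=
  NormedSpace.exp ((Complex.I * (t : ℂ)) • Γ.hermitianAdj)

/-- Perfect state transfer from `u` to `v`: `U(t) e_u = γ e_v` for some real `t` and some
unimodular `γ`. (As `t` may be negative, this relation is symmetric in `u` and `v`.) -/
def HasPST [Fintype V] [DecidableEq V] (Γ : MixedGraph V) (u v : V) : Prop :=
  ∃ (t : ℝ) (γ : ℂ), ‖γ‖ = 1 ∧
    Matrix.mulVec (Γ.transition t) (Pi.single u (1 : ℂ)) = γ • (Pi.single v (1 : ℂ) : V → ℂ)

end MixedGraph

/-- The elements `c` of `C` with `-c ∉ C`. -/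
def orientedPart {n : ℕ} (C : Set (ZMod n)) : Set (ZMod n) := {c | c ∈ C ∧ -c ∉ C}

/-- The mixed circulant graph `G(ℤ_n, C)`, for a connection set `C` not containing `0`. -/
def mixedCirculant {n : ℕ} (C : Set (ZMod n)) (h0 : (0 : ZMod n) ∉ C) : MixedGraph (ZMod n) where
  edge a b := b - a ∈ C \ orientedPart C
  arc a b := b - a ∈ orientedPart C
  edge_symm := by
    rintro u v ⟨h1, h2⟩
    have h3 : -(v - u) ∈ C := by
      by_contra h
      exact h2 ⟨h1, h⟩
    rw [neg_sub] at h3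
    refine ⟨h3, fun h => h.2 ?_⟩
    rwa [neg_sub]
  edge_irrefl := by
    rintro u ⟨h1, -⟩
    rw [sub_self] at h1
    exact h0 h1
  arc_asymm := by
    intro u v h1 h2
    apply h1.2
    rw [neg_sub]
    exact h2.1
  edge_not_arc := fun _ _ h1 h2 => h1.2 h2

/-- `G_n(d) = {1 ≤ k ≤ n - 1 : gcd(k, n) = d}`, as a subset of `ℤ_n`. -/
def gcdClass (n d : ℕ) : Set (ZMod n) := {k | 1 ≤ k.val ∧ Nat.gcd k.val n = d}

/-- `G_n^r(d) = d · G_{n/d}^r(1)`: the `k = d m` in `G_n(d)` with `m ≡ r (mod 4)`. -/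
def gcdClassMod (n d : ℕ) (r : ℤ) : Set (ZMod n) :=
  {k | k ∈ gcdClass n d ∧ ∃ m : ℕ, k.val = d * m ∧ (m : ℤ) ≡ r [ZMOD 4]}

/-- The connection set of `IMCG_n(B, D, σ)`. A sign `-1` selects the residue `-1 ≡ 3 (mod 4)`. -/
def imcgSet (n : ℕ) (B D : Finset ℕ) (σ : {d // d ∈ D} → ℤˣ) : Set (ZMod n) :=
  (⋃ d ∈ B, gcdClass n d) ∪ ⋃ d : {d // d ∈ D}, gcdClassMod n d.1 (σ d : ℤ)

theorem zero_notMem_imcgSet (n : ℕ) (B D : Finset ℕ) (σ : {d // d ∈ D} → ℤˣ) :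
    (0 : ZMod n) ∉ imcgSet n B D σ := by
  simp [imcgSet, gcdClassMod, gcdClass]

/-- The mixed circulant graph `IMCG_n(B, D, σ)`. -/
def imcg (n : ℕ) (B D : Finset ℕ) (σ : {d // d ∈ D} → ℤˣ) : MixedGraph (ZMod n) :=
  mixedCirculant (imcgSet n B D σ) (zero_notMem_imcgSet n B D σ)

/-- `A_i`: the `d` in `A` such that the exact power of `2` dividing `n / d` is `2 ^ i`. -/
def layer (n : ℕ) (A : Finset ℕ) (i : ℕ) : Finset ℕ :=
  A.filter fun d => padicValNat 2 (n / d) = i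

/-- `A*_i = A_i \ {n / 2 ^ i}`. (If `2 ^ i` does not divide `n`, then for sets `A` of divisors of
`n` the layer `A_i` is empty and nothing is removed.) -/
def layerStar (n : ℕ) (A : Finset ℕ) (i : ℕ) : Finset ℕ := layer n A i \ {n / 2 ^ i}

/-- `k A = {k a : a ∈ A}`. -/
def dilate (k : ℕ) (A : Finset ℕ) : Finset ℕ := A.image fun a => k * a

/-!
The Fourier transform diagonalises every circulant matrix, so state transfer over half of the cycle
is a condition on the eigenvalues alone. Here they form an integral sequence `Λ`, and the condition
is that, for some `v`, `Λ j` is congruent to `Λ 0 + 2 ^ v * j` modulo `2 ^ (v + 1)` for all `j`.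

Write `n = 2 ^ e * m` with `m` odd and sort the residues `c` by the exact power `2 ^ a` of two that
divides `n / gcd c n`. The level `a` contributes to `Λ j` an explicit sum over odd residues modulo
`2 ^ a` times the transform of a function of `gcd x m`. Since `m` is odd, Möbius inversion is
available modulo powers of two: congruences between the values of such transforms become congruences
between the coefficients, which lie in `{-1, 0, 1}`. At the proper divisors of `m` this forces the
equalities between the layers. Parity excludes `v = 0`, and the coefficients at `m` itself exclude
`3 ≤ v`; then `v = 1` gives the cases (i) and (ii), and `v = 2` gives the case (iii).
-/

open Finset

theorem mul_exp_smul_of_mul_eq_diagonal_mul {ι : Type*} [Fintype ι] [DecidableEq ι]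
    {P H : Matrix ι ι ℂ} {μ : ι → ℂ} (h : P * H = Matrix.diagonal μ * P) (s : ℂ) :
    P * NormedSpace.exp (s • H) = Matrix.diagonal (fun i => Complex.exp (s * μ i)) * P := by
  let _ : NormedRing (Matrix ι ι ℂ) := Matrix.linftyOpNormedRing
  let _ : NormedAlgebra ℂ (Matrix ι ι ℂ) := Matrix.linftyOpNormedAlgebra
  let _ : NormedAlgebra ℚ (Matrix ι ι ℂ) := NormedAlgebra.restrictScalars ℚ ℂ _
  have hs : SemiconjBy P (s • H) (Matrix.diagonal (s • μ)) := by
    rw [SemiconjBy, Matrix.mul_smul, h, ← Matrix.smul_mul, Matrix.diagonal_smul]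
  have hdiag : NormedSpace.exp (Matrix.diagonal (s • μ)) =
      Matrix.diagonal (fun i => Complex.exp (s * μ i)) := by
    refine (Matrix.exp_diagonal (s • μ)).trans (congrArg _ (funext fun i => ?_))
    rw [Pi.exp_def, Complex.exp_eq_exp_ℂ]
    rfl
  exact hs.exp_right.trans (congrArg (· * P) hdiag)

/-- The matrix of the discrete Fourier transform on `ZMod n`. -/
noncomputable def fourierMatrix (n : ℕ) [NeZero n] : Matrix (ZMod n) (ZMod n) ℂ :=
  Matrix.of fun k u => ZMod.stdAddChar (-(u * k))

theorem fourierMatrix_mulVec_injective (n : ℕ) [NeZero n] :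
    Function.Injective (fourierMatrix n).mulVec := by
  have hdft : (fourierMatrix n).mulVec = (ZMod.dft : (ZMod n → ℂ) ≃ₗ[ℂ] (ZMod n → ℂ)) := by
    funext Φ k
    simp [fourierMatrix, Matrix.mulVec, dotProduct, ZMod.dft_apply]
  rw [hdft]
  exact LinearEquiv.injective _

theorem fourierMatrix_mul_circulant {n : ℕ} [NeZero n] (f : ZMod n → ℂ) :
    fourierMatrix n * (Matrix.of fun u v => f (v - u)) =
      Matrix.diagonal (fun k => ∑ c, f c * ZMod.stdAddChar (c * k)) * fourierMatrix n := by
  ext k v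
  rw [Matrix.diagonal_mul, Matrix.mul_apply, Finset.sum_mul]
  refine Fintype.sum_equiv (Equiv.subLeft v) _ _ fun u => ?_
  simp only [fourierMatrix, Matrix.of_apply, Equiv.subLeft_apply]
  rw [mul_comm, mul_assoc, ← AddChar.map_add_eq_mul]
  congr 2
  ring

theorem transition_mulVec_single_iff {n : ℕ} [NeZero n] (Γ : MixedGraph (ZMod n))
    (f : ZMod n → ℂ) (hf : ∀ u v, Γ.hermitianAdj u v = f (v - u)) (t : ℝ) (γ : ℂ)
    (u v : ZMod n) :
    Matrix.mulVec (Γ.transition t) (Pi.single u (1 : ℂ)) =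
        γ • (Pi.single v (1 : ℂ) : ZMod n → ℂ) ↔
      ∀ k : ZMod n, Complex.exp (Complex.I * t * ∑ c, f c * ZMod.stdAddChar (c * k)) *
        ZMod.stdAddChar (-(u * k)) = γ * ZMod.stdAddChar (-(v * k)) := by
  have hH : Γ.hermitianAdj = Matrix.of fun u v => f (v - u) := by
    ext a b
    exact hf a b
  rw [← (fourierMatrix_mulVec_injective n).eq_iff, MixedGraph.transition, hH,
    Matrix.mulVec_mulVec, mul_exp_smul_of_mul_eq_diagonal_mul (fourierMatrix_mul_circulant f),
    funext_iff]
  refine forall_congr' fun k => ?_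
  rw [Matrix.mulVec_single_one, Matrix.mulVec_smul, Matrix.mulVec_single_one]
  simp [Matrix.diagonal_mul, fourierMatrix]

theorem stdAddChar_natCast_mul {N p q : ℕ} [NeZero N] [NeZero q] (h : N = p * q) (k : ℕ) :
    ZMod.stdAddChar ((p * k : ℕ) : ZMod N) = ZMod.stdAddChar (k : ZMod q) := by
  subst h
  have hp : (p : ℂ) ≠ 0 := Nat.cast_ne_zero.2 (left_ne_zero_of_mul (NeZero.ne (p * q)))
  have h1 := ZMod.stdAddChar_coe (N := p * q) (p * k : ℕ)
  have h2 := ZMod.stdAddChar_coe (N := q) k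
  rw [Int.cast_natCast] at h1 h2
  rw [h1, h2]
  congr 1
  push_cast
  field_simp

theorem stdAddChar_two_natCast (j : ℕ) : ZMod.stdAddChar (j : ZMod 2) = (-1 : ℂ) ^ j := by
  have h := ZMod.stdAddChar_coe (N := 2) j
  rw [Int.cast_natCast] at h
  rw [h, ← Complex.exp_pi_mul_I, ← Complex.exp_nat_mul]
  congr 1
  push_cast
  ring

theorem stdAddChar_half_mul {n : ℕ} [NeZero n] (hn : Even n) (j : ℕ) :
    ZMod.stdAddChar (((n / 2 : ℕ) : ZMod n) * (j : ZMod n)) = (-1 : ℂ) ^ j := by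
  rw [← Nat.cast_mul, stdAddChar_natCast_mul (Nat.div_two_mul_two_of_even hn).symm,
    stdAddChar_two_natCast]

theorem forall_hasPST_iff {n : ℕ} [NeZero n] (hn : Even n) (Γ : MixedGraph (ZMod n))
    (f : ZMod n → ℂ) (hf : ∀ u v, Γ.hermitianAdj u v = f (v - u)) (Λ : ℕ → ℤ)
    (hΛ : ∀ j : ℕ, ∑ c, f c * ZMod.stdAddChar (c * (j : ZMod n)) = Λ j) :
    (∀ b, Γ.HasPST (b + ((n / 2 : ℕ) : ZMod n)) b) ↔
      ∃ (t : ℝ) (γ : ℂ), ‖γ‖ = 1 ∧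
        ∀ j : ℕ, Complex.exp (Complex.I * t * Λ j) * (-1) ^ j = γ := by
  have key : ∀ b t γ, Matrix.mulVec (Γ.transition t)
      (Pi.single (b + ((n / 2 : ℕ) : ZMod n)) (1 : ℂ)) =
        γ • (Pi.single b (1 : ℂ) : ZMod n → ℂ) ↔
      ∀ j : ℕ, Complex.exp (Complex.I * t * Λ j) * (-1) ^ j = γ := by
    intro b t γ
    rw [transition_mulVec_single_iff Γ f hf, (ZMod.natCast_zmod_surjective (n := n)).forall]
    refine forall_congr' fun j => ?_
    have hne : (ZMod.stdAddChar (-(b * (j : ZMod n))) : ℂ) ≠ 0 := by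
      rw [ZMod.stdAddChar_apply]
      exact Circle.coe_ne_zero _
    rw [hΛ, add_mul, neg_add, AddChar.map_add_eq_mul, AddChar.map_neg_eq_inv _ (_ * _),
      AddChar.map_neg_eq_inv, stdAddChar_half_mul hn, ← inv_pow, inv_neg_one,
      mul_comm _ ((-1 : ℂ) ^ j), ← mul_assoc, mul_left_inj' (by rwa [← AddChar.map_neg_eq_inv])]
  simp only [MixedGraph.HasPST, key, forall_const]

/-- Modulo `2 ^ (v + 1)`, the sequence `Λ` takes the value `Λ 0` at even indices and
`Λ 0 + 2 ^ v` at odd ones. For an integral spectrum this is the phase condition of state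
transfer over half of the cycle. -/
def AlternatesTwoAdically (Λ : ℕ → ℤ) (v : ℕ) : Prop :=
  ∀ j : ℕ, Λ j ≡ Λ 0 + 2 ^ v * j [ZMOD 2 ^ (v + 1)]

theorem exp_mul_neg_one_pow_eq_exp_iff (x y : ℝ) (j : ℕ) :
    Complex.exp (Complex.I * x) * (-1) ^ j = Complex.exp (Complex.I * y) ↔
      ∃ l : ℤ, x - y = Real.pi * (j + 2 * l) := by
  rw [← Complex.exp_pi_mul_I, ← Complex.exp_nat_mul, ← Complex.exp_add,
    Complex.exp_eq_exp_iff_exists_int]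
  refine ⟨fun ⟨l, hl⟩ => ⟨l - j, ?_⟩, fun ⟨l, hl⟩ => ⟨l + j, ?_⟩⟩
  · have : ((x - y : ℝ) : ℂ) = ((Real.pi * (j + 2 * (l - j : ℤ)) : ℝ) : ℂ) := by
      refine mul_left_cancel₀ Complex.I_ne_zero ?_
      push_cast
      linear_combination hl
    exact_mod_cast this
  · have : (x : ℂ) - y = Real.pi * (j + 2 * l) := by exact_mod_cast congrArg Complex.ofReal hl
    push_cast
    linear_combination Complex.I * this

theorem exists_two_pow_modEq_of_forall_real_mul {δ : ℕ → ℤ} {s : ℝ}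
    (h : ∀ j : ℕ, ∃ l : ℤ, s * δ j = j + 2 * l) :
    ∃ v : ℕ, ∀ j : ℕ, δ j ≡ 2 ^ v * j [ZMOD 2 ^ (v + 1)] := by
  choose l hl using h
  have hodd : (1 : ℤ) + 2 * l 1 ≠ 0 := by omega
  have h1 : s * δ 1 = ((1 + 2 * l 1 : ℤ) : ℝ) := by
    rw [hl]
    push_cast
    ring
  have hs1 : s * δ 1 ≠ 0 := by
    rw [h1]
    exact_mod_cast hodd
  have hcross (j : ℕ) : δ j * (1 + 2 * l 1) = δ 1 * (j + 2 * l j) := by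
    have : s * (δ j * (1 + 2 * l 1)) = s * (δ 1 * (j + 2 * l j)) := by
      have h2 := hl j
      push_cast at h1
      linear_combination (1 + 2 * (l 1 : ℝ)) * h2 - (j + 2 * (l j : ℝ)) * h1
    exact_mod_cast mul_left_cancel₀ (left_ne_zero_of_mul hs1) this
  obtain ⟨z, hz, hz2⟩ := (Int.finiteMultiplicity_iff.2 ⟨by decide, by
    exact_mod_cast right_ne_zero_of_mul hs1⟩ :
      FiniteMultiplicity (2 : ℤ) (δ 1)).exists_eq_pow_mul_and_not_dvd
  set v := multiplicity 2 (δ 1)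
  refine ⟨v, fun j => ?_⟩
  have hcop : IsCoprime ((2 : ℤ) ^ v) (1 + 2 * l 1) := IsCoprime.pow_left ⟨-l 1, 1, by ring⟩
  obtain ⟨y, hy⟩ : (2 : ℤ) ^ v ∣ δ j := by
    refine hcop.dvd_of_dvd_mul_right ?_
    rw [hcross, hz, mul_assoc]
    exact dvd_mul_right _ _
  have hyz : y * (1 + 2 * l 1) = z * (j + 2 * l j) := by
    have := hcross j
    rw [hy, hz, mul_assoc, mul_assoc] at this
    exact mul_left_cancel₀ (by positivity) this
  obtain ⟨o, rfl⟩ : ∃ o, z = 2 * o + 1 := ⟨z / 2, by omega⟩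
  rw [hy, pow_succ]
  refine Int.ModEq.mul_left' (Int.modEq_iff_dvd.2 ⟨y * l 1 - o * (j + 2 * l j) - l j, ?_⟩)
  linear_combination -hyz

theorem exists_time_iff (Λ : ℕ → ℤ) :
    (∃ (t : ℝ) (γ : ℂ), ‖γ‖ = 1 ∧
        ∀ j : ℕ, Complex.exp (Complex.I * t * Λ j) * (-1) ^ j = γ) ↔
      ∃ v, AlternatesTwoAdically Λ v := by
  have hexp (t : ℝ) (j : ℕ) : Complex.exp (Complex.I * t * Λ j) =
      Complex.exp (Complex.I * (t * Λ j : ℝ)) := by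
    push_cast
    rw [mul_assoc]
  simp only [hexp]
  constructor
  · rintro ⟨t, γ, -, h⟩
    have h0 := h 0
    rw [pow_zero, mul_one] at h0
    obtain ⟨v, hv⟩ : ∃ v : ℕ, ∀ j : ℕ, Λ j - Λ 0 ≡ 2 ^ v * j [ZMOD 2 ^ (v + 1)] := by
      refine exists_two_pow_modEq_of_forall_real_mul (s := t / Real.pi) fun j => ?_
      obtain ⟨l, hl⟩ := (exp_mul_neg_one_pow_eq_exp_iff _ _ _).1 ((h j).trans h0.symm)
      refine ⟨l, ?_⟩
      have hpi := Real.pi_ne_zero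
      push_cast
      field_simp
      linear_combination hl
    exact ⟨v, fun j => by simpa using (hv j).add_left (Λ 0)⟩
  · rintro ⟨v, h⟩
    refine ⟨Real.pi / 2 ^ v, Complex.exp (Complex.I * (Real.pi / 2 ^ v * Λ 0 : ℝ)), ?_,
      fun j => (exp_mul_neg_one_pow_eq_exp_iff _ _ _).2 ?_⟩
    · rw [mul_comm, Complex.norm_exp_ofReal_mul_I]
    · obtain ⟨q, hq⟩ := Int.modEq_iff_dvd.1 (h j)
      refine ⟨-q, ?_⟩
      have hΛ : (Λ 0 : ℝ) + 2 ^ v * j - Λ j = 2 ^ (v + 1) * q := by exact_mod_cast hq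
      push_cast
      field_simp
      linear_combination -hΛ

section EvenDFT
open scoped ArithmeticFunction.Moebius

theorem sum_range_eq_sum_zmod {M : Type*} [AddCommMonoid M] (q : ℕ) [NeZero q] (F : ZMod q → M) :
    ∑ t ∈ range q, F t = ∑ x, F x :=
  sum_nbij' (fun t => (t : ZMod q)) ZMod.val (fun _ _ => mem_univ _)
    (fun x _ => mem_range.2 x.val_lt) (fun _ ht => ZMod.val_natCast_of_lt (mem_range.1 ht))
    (fun x _ => ZMod.natCast_zmod_val x) fun _ _ => rfl

theorem sum_range_stdAddChar_mul (q : ℕ) [NeZero q] (w : ℕ) :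
    ∑ t ∈ range q, ZMod.stdAddChar ((t * w : ℕ) : ZMod q) = if q ∣ w then (q : ℂ) else 0 := by
  simp_rw [Nat.cast_mul, sum_range_eq_sum_zmod q fun x => ZMod.stdAddChar (x * (w : ZMod q)),
    AddChar.sum_mulShift _ (ZMod.isPrimitive_stdAddChar q), ZMod.card, Nat.cast_ite, Nat.cast_zero,
    ZMod.natCast_eq_zero_iff]

theorem sum_range_mul_dvd {M : Type*} [AddCommMonoid M] {d : ℕ} (hd : 0 < d) (q : ℕ)
    (F : ℕ → M) : ∑ x ∈ range (d * q) with d ∣ x, F x = ∑ t ∈ range q, F (d * t) := by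
  refine (sum_nbij (d * ·) (fun t ht => ?_) (fun _ _ _ _ h => Nat.eq_of_mul_eq_mul_left hd h)
    (fun x hx => ?_) fun _ _ => rfl).symm
  · have hlt := Nat.mul_lt_mul_of_pos_left (mem_range.1 ht) hd
    exact mem_filter.2 ⟨mem_range.2 hlt, d.dvd_mul_right t⟩
  · obtain ⟨hx, t, rfl⟩ := mem_filter.1 (mem_coe.1 hx)
    exact ⟨t, mem_coe.2 (mem_range.2 (Nat.lt_of_mul_lt_mul_left (mem_range.1 hx))), rfl⟩

/-- The value at `d` of the function `h'` on the positive integers with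
`h n = ∑ i ∈ n.divisors, h' i`, as a linear functional of `h`. -/
def moebiusInverse (d : ℕ) : (ℕ → ℤ) →ₗ[ℤ] ℤ :=
  ∑ p ∈ d.divisorsAntidiagonal, μ p.1 • LinearMap.proj p.2

theorem sum_divisors_moebiusInverse (h : ℕ → ℤ) {d : ℕ} (hd : 0 < d) :
    ∑ i ∈ d.divisors, moebiusInverse i h = h d :=
  (ArithmeticFunction.sum_eq_iff_sum_mul_moebius_eq (R := ℤ)).2
    (fun _ _ => by simp [moebiusInverse]) d hd

/-- The discrete Fourier transform at `w` of the function `x ↦ h (gcd x m)` modulo `m`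
(see `sum_range_gcd_mul_stdAddChar`), written through Möbius inversion, so that its values are
visibly integers. -/
def evenDFT (m w : ℕ) : (ℕ → ℤ) →ₗ[ℤ] ℤ :=
  ∑ q ∈ (Nat.gcd w m).divisors, (q : ℤ) • moebiusInverse (m / q)

theorem evenDFT_apply (m w : ℕ) (h : ℕ → ℤ) :
    evenDFT m w h = ∑ q ∈ (Nat.gcd w m).divisors, q * moebiusInverse (m / q) h := by
  simp [evenDFT]

theorem sum_range_gcd_mul_stdAddChar (m : ℕ) [NeZero m] (h : ℕ → ℤ) (w : ℕ) :
    ∑ x ∈ range m, (h (Nat.gcd x m) : ℂ) * ZMod.stdAddChar ((x * w : ℕ) : ZMod m) =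
      evenDFT m w h := by
  have hm : 0 < m := NeZero.pos m
  have hmultiples (d : ℕ) (hd : d ∈ m.divisors) :
      ∑ x ∈ range m with d ∣ x, ZMod.stdAddChar ((x * w : ℕ) : ZMod m) =
        if m / d ∣ w then ((m / d : ℕ) : ℂ) else 0 := by
    obtain ⟨⟨q, rfl⟩, -⟩ := Nat.mem_divisors.1 hd
    have hd0 : 0 < d := Nat.pos_of_mul_pos_right hm
    have : NeZero q := ⟨(Nat.pos_of_mul_pos_left hm).ne'⟩
    rw [sum_range_mul_dvd hd0, Nat.mul_div_cancel_left _ hd0, ← sum_range_stdAddChar_mul]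
    simp_rw [mul_assoc, stdAddChar_natCast_mul rfl]
  have hgcd (x : ℕ) : h (Nat.gcd x m) = ∑ d ∈ m.divisors with d ∣ x, moebiusInverse d h := by
    rw [← sum_divisors_moebiusInverse h (Nat.gcd_pos_of_pos_right x hm)]
    refine sum_congr ?_ fun _ _ => rfl
    ext d
    simp [Nat.dvd_gcd_iff, hm.ne', and_comm]
  calc ∑ x ∈ range m, (h (Nat.gcd x m) : ℂ) * ZMod.stdAddChar ((x * w : ℕ) : ZMod m)
      = ∑ d ∈ m.divisors, (moebiusInverse d h : ℂ) *
          ∑ x ∈ range m with d ∣ x, ZMod.stdAddChar ((x * w : ℕ) : ZMod m) := by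
        simp_rw [hgcd, Int.cast_sum, sum_mul, mul_sum, sum_filter]
        exact sum_comm
    _ = ∑ d ∈ m.divisors, if m / d ∣ w then ((m / d : ℕ) : ℂ) * moebiusInverse d h else 0 := by
        refine sum_congr rfl fun d hd => ?_
        rw [hmultiples d hd, mul_ite, mul_zero, mul_comm]
    _ = ∑ q ∈ m.divisors, if q ∣ w then (q : ℂ) * moebiusInverse (m / q) h else 0 := by
        rw [← Nat.sum_div_divisors]
        refine sum_congr rfl fun d hd => ?_
        rw [Nat.div_div_self (Nat.dvd_of_mem_divisors hd) hm.ne']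
    _ = evenDFT m w h := by
        rw [evenDFT_apply, Int.cast_sum, ← sum_filter]
        refine sum_congr ?_ fun _ _ => by push_cast; rfl
        ext q
        simp [Nat.dvd_gcd_iff, hm.ne', and_comm]

theorem evenDFT_congr (m : ℕ) {w w' : ℕ} (hw : w ≡ w' [MOD m]) : evenDFT m w = evenDFT m w' := by
  rw [evenDFT, evenDFT, hw.gcd_eq]

theorem evenDFT_eq_self {m : ℕ} [NeZero m] {h : ℕ → ℤ} (hh : ∀ g ∈ m.properDivisors, h g = 0)
    (w : ℕ) : evenDFT m w h = h m := by
  have hsum := sum_range_gcd_mul_stdAddChar m h w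
  rw [sum_eq_single_of_mem 0 (mem_range.2 (NeZero.pos m)) fun x hx hx0 => ?_] at hsum
  · simpa using hsum.symm
  · rw [hh _ (Nat.mem_properDivisors.2 ⟨Nat.gcd_dvd_right x m, ?_⟩), Int.cast_zero, zero_mul]
    exact (Nat.gcd_le_left m (Nat.pos_of_ne_zero hx0)).trans_lt (mem_range.1 hx)

theorem dvd_moebiusInverse_of_forall_evenDFT_modEq {m : ℕ} [NeZero m] {M : ℤ} (hM : IsCoprime M m)
    {h : ℕ → ℤ} {c : ℤ} (hc : ∀ w, evenDFT m w h ≡ c [ZMOD M]) {q : ℕ} (hq : q ∣ m)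
    (hq1 : q ≠ 1) : M ∣ moebiusInverse (m / q) h := by
  induction q using Nat.strong_induction_on with
  | _ q ih =>
    have hq0 : 0 < q := Nat.pos_of_dvd_of_pos hq (NeZero.pos m)
    have hone : (1 : ℕ) ∈ q.divisors := Nat.one_mem_divisors.2 hq0.ne'
    have hself : q ∈ q.divisors.erase 1 := mem_erase.2 ⟨hq1, Nat.mem_divisors_self q hq0.ne'⟩
    have hdiff : M ∣ evenDFT m q h - evenDFT m 1 h := ((hc 1).trans (hc q).symm).dvd
    rw [evenDFT_apply, evenDFT_apply, Nat.gcd_eq_left hq, Nat.gcd_one_left, Nat.divisors_one,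
      sum_singleton, ← add_sum_erase _ _ hone, add_sub_cancel_left,
      ← add_sum_erase _ _ hself] at hdiff
    have hsmall : M ∣ ∑ r ∈ (q.divisors.erase 1).erase q, r * moebiusInverse (m / r) h := by
      refine dvd_sum fun r hr => dvd_mul_of_dvd_right ?_ _
      obtain ⟨hrq, hr1, hr⟩ : r ≠ q ∧ r ≠ 1 ∧ r ∈ q.divisors := by simpa using hr
      have hrq' := Nat.dvd_of_mem_divisors hr
      exact ih r ((Nat.le_of_dvd hq0 hrq').lt_of_ne hrq) (hrq'.trans hq) hr1
    have hMq : IsCoprime M q := hM.of_isCoprime_of_dvd_right (Int.natCast_dvd_natCast.2 hq)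
    exact hMq.dvd_of_dvd_mul_left ((dvd_add_left hsmall).1 hdiff)

theorem dvd_of_forall_evenDFT_modEq {m : ℕ} [NeZero m] {M : ℤ} (hM : IsCoprime M m) {h : ℕ → ℤ}
    {c : ℤ} (hc : ∀ w, evenDFT m w h ≡ c [ZMOD M]) {g : ℕ} (hg : g ∈ m.properDivisors) :
    M ∣ h g := by
  obtain ⟨hgm, hlt⟩ := Nat.mem_properDivisors.1 hg
  rw [← sum_divisors_moebiusInverse h (Nat.pos_of_dvd_of_pos hgm (NeZero.pos m))]
  refine dvd_sum fun i hi => ?_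
  have him : i ∣ m := (Nat.dvd_of_mem_divisors hi).trans hgm
  rw [← Nat.div_div_self him (NeZero.ne m)]
  refine dvd_moebiusInverse_of_forall_evenDFT_modEq hM hc (Nat.div_dvd_of_dvd him) fun h1 => ?_
  have : i = m := Nat.eq_of_dvd_of_div_eq_one him h1
  exact hlt.not_ge (this ▸ Nat.divisor_le hi)

end EvenDFT

theorem sum_range_mul_eq_sum_sum {M : Type*} [AddCommMonoid M] (p q : ℕ) (f : ℕ → M) :
    ∑ y ∈ range (p * q), f y = ∑ t ∈ range q, ∑ r ∈ range p, f (p * t + r) := by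
  induction q with
  | zero => simp
  | succ q ih => rw [mul_add_one, sum_range_add, ih, sum_range_succ]

theorem sum_range_two_pow {M : Type*} [AddCommMonoid M] (G : ℕ → M) (e : ℕ) :
    ∑ y ∈ range (2 ^ e), G y =
      ∑ a ∈ range (e + 1), ∑ y ∈ range (2 ^ a) with y.Coprime (2 ^ a), G (2 ^ (e - a) * y) := by
  induction e generalizing G with
  | zero => simp
  | succ e ih =>
    have hodd : ∑ y ∈ range (2 ^ (e + 1)) with y.Coprime (2 ^ (e + 1)), G y =
        ∑ t ∈ range (2 ^ e), G (2 * t + 1) := by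
      have hcop (y : ℕ) : y.Coprime (2 ^ (e + 1)) ↔ Odd y := by
        rw [Nat.coprime_pow_right_iff e.succ_pos, Nat.coprime_two_right]
      have hnot (t : ℕ) : ¬ Odd (2 * t) := Nat.not_odd_iff_even.2 (even_two_mul t)
      rw [sum_filter, pow_succ', sum_range_mul_eq_sum_sum]
      simp [← pow_succ', hcop, hnot, sum_range_succ]
    rw [sum_range_succ _ (e + 1), Nat.sub_self]
    simp only [pow_zero, one_mul]
    rw [hodd, pow_succ', sum_range_mul_eq_sum_sum]
    simp only [sum_range_succ _ 1, sum_range_one, add_zero, sum_add_distrib]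
    rw [ih fun y => G (2 * y)]
    refine congrArg (· + _) (sum_congr rfl fun a ha => sum_congr rfl fun y _ => ?_)
    rw [Nat.succ_sub (mem_range_succ_iff.1 ha), pow_succ', mul_assoc]

theorem sum_range_mul_mul_stdAddChar {p q : ℕ} [NeZero p] [NeZero q] (ψ : ZMod p → ℂ) (j : ℕ) :
    ∑ y ∈ range (p * q), ψ y * ZMod.stdAddChar ((y * j : ℕ) : ZMod (p * q)) =
      if q ∣ j then q * ∑ r ∈ range p, ψ r * ZMod.stdAddChar ((r * (j / q) : ℕ) : ZMod p)
      else 0 := by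
  have hsplit (t r : ℕ) : ψ ((p * t + r : ℕ) : ZMod p) *
      ZMod.stdAddChar (((p * t + r) * j : ℕ) : ZMod (p * q)) =
        ZMod.stdAddChar ((t * j : ℕ) : ZMod q) *
          (ψ r * ZMod.stdAddChar ((r * j : ℕ) : ZMod (p * q))) := by
    rw [add_mul, mul_assoc, Nat.cast_add (p * (t * j)), AddChar.map_add_eq_mul,
      stdAddChar_natCast_mul rfl, Nat.cast_add, Nat.cast_mul p t, CharP.cast_eq_zero, zero_mul,
      zero_add, mul_left_comm]
  simp_rw [sum_range_mul_eq_sum_sum, hsplit, ← mul_sum, ← sum_mul, sum_range_stdAddChar_mul,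
    ite_mul, zero_mul]
  refine ite_congr rfl (fun ⟨s, hs⟩ => ?_) fun _ => rfl
  rw [hs, Nat.mul_div_cancel_left _ (NeZero.pos q)]
  simp_rw [mul_left_comm _ q s, stdAddChar_natCast_mul (mul_comm p q)]

theorem stdAddChar_four_natCast (j : ℕ) : ZMod.stdAddChar (j : ZMod 4) = Complex.I ^ j := by
  have h := ZMod.stdAddChar_coe (N := 4) j
  rw [Int.cast_natCast] at h
  rw [h, Eq.comm]
  nth_rw 1 [← Complex.exp_pi_div_two_mul_I]
  rw [← Complex.exp_nat_mul]
  congr 1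
  push_cast
  ring

theorem χ₄_natCast_of_even {y : ℕ} (hy : Even y) : ZMod.χ₄ y = 0 := by
  rw [ZMod.χ₄_nat_eq_if_mod_four, if_pos (Nat.even_iff.1 hy)]

theorem χ₄_natCast_of_odd {y : ℕ} (hy : Odd y) : ZMod.χ₄ y = 1 ∨ ZMod.χ₄ y = -1 := by
  rw [ZMod.χ₄_eq_neg_one_pow (Nat.odd_iff.1 hy)]
  exact neg_one_pow_eq_or ℤ _

theorem sum_range_four_χ₄_mul_I_pow (β κ : ℂ) (s : ℕ) :
    ∑ r ∈ range 4, ((ZMod.χ₄ r : ℂ) ^ 2 * β + Complex.I * ZMod.χ₄ r * κ) * Complex.I ^ (r * s) =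
      2 * (ZMod.χ₄ (s + 1 : ℕ) * β - ZMod.χ₄ s * κ) := by
  have h0 : ZMod.χ₄ (0 : ℕ) = 0 := rfl
  have h1 : ZMod.χ₄ (1 : ℕ) = 1 := rfl
  have h2 : ZMod.χ₄ (2 : ℕ) = 0 := rfl
  have h3 : ZMod.χ₄ (3 : ℕ) = -1 := rfl
  have hI : Complex.I ^ (3 * s) = Complex.I ^ (3 * (s % 4)) := by
    rw [mul_comm, pow_mul, Complex.I_pow_eq_pow_mod, mul_comm, pow_mul]
  simp only [sum_range_succ, sum_range_zero, h0, h1, h2, h3, hI]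
  rw [one_mul, Complex.I_pow_eq_pow_mod s, ZMod.χ₄_nat_mod_four, ZMod.χ₄_nat_mod_four s,
    Nat.add_mod]
  have hs := Nat.mod_lt s four_pos
  interval_cases s % 4 <;> simp [Complex.I_pow_eq_pow_mod] <;> ring_nf <;> simp <;> ring

/-- `∑ y, (β + i χ₄(y) κ) exp (2 π i y j / 2 ^ a)` over `y < 2 ^ a` coprime to `2 ^ a`
(see `sum_range_coprime_two_pow`), for integers `β` and `κ` with `κ = 0` if `a = 1`. -/
def twoPowSum (j : ℕ) (β κ : ℤ) : ℕ → ℤ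
  | 0 => β
  | 1 => (-1) ^ j * β
  | a + 2 => if 2 ^ a ∣ j then
      2 ^ (a + 1) * (ZMod.χ₄ ((j / 2 ^ a + 1 : ℕ) : ZMod 4) * β -
        ZMod.χ₄ ((j / 2 ^ a : ℕ) : ZMod 4) * κ) else 0

theorem sum_range_coprime_two_pow (a j : ℕ) (β κ : ℤ) (hκ : a = 1 → κ = 0) :
    ∑ y ∈ range (2 ^ a) with y.Coprime (2 ^ a), (β + Complex.I * ZMod.χ₄ y * κ) *
      ZMod.stdAddChar ((y * j : ℕ) : ZMod (2 ^ a)) = twoPowSum j β κ a := by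
  obtain _ | _ | a := a
  · simp [twoPowSum]
  · simp [hκ, sum_filter, sum_range_succ, twoPowSum, mul_comm, stdAddChar_two_natCast j]
  · have hodd (y : ℕ) : (if y.Coprime (2 ^ (a + 2)) then ((β : ℂ) + Complex.I * ZMod.χ₄ y * κ) *
        ZMod.stdAddChar ((y * j : ℕ) : ZMod (2 ^ (a + 2))) else 0) =
          ((ZMod.χ₄ y : ℂ) ^ 2 * β + Complex.I * ZMod.χ₄ y * κ) *
            ZMod.stdAddChar ((y * j : ℕ) : ZMod (4 * 2 ^ a)) := by
      have hchar : ZMod.stdAddChar ((y * j : ℕ) : ZMod (2 ^ (a + 2))) =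
          ZMod.stdAddChar ((y * j : ℕ) : ZMod (4 * 2 ^ a)) := by
        have hN : 2 ^ (a + 2) = 1 * (4 * 2 ^ a) := by ring
        rw [← stdAddChar_natCast_mul hN, one_mul]
      have hcop : y.Coprime (2 ^ (a + 2)) ↔ Odd y := by
        rw [Nat.coprime_pow_right_iff (by lia), Nat.coprime_two_right]
      simp only [hchar, hcop]
      split_ifs with hy
      · obtain h | h := χ₄_natCast_of_odd hy <;> simp [h]
      · simp [χ₄_natCast_of_even (Nat.not_odd_iff_even.1 hy)]
    simp_rw [sum_filter, hodd]
    rw [show 2 ^ (a + 1 + 1) = 4 * 2 ^ a by ring, sum_range_mul_mul_stdAddChar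
      fun y => (ZMod.χ₄ y : ℂ) ^ 2 * β + Complex.I * ZMod.χ₄ y * κ]
    simp_rw [stdAddChar_four_natCast, sum_range_four_χ₄_mul_I_pow, twoPowSum]
    split_ifs
    · push_cast
      ring
    · rw [Int.cast_zero]

open Classical in
theorem hermitianAdj_mixedCirculant {n : ℕ} (C : Set (ZMod n)) (h0 : (0 : ZMod n) ∉ C)
    (u v : ZMod n) : (mixedCirculant C h0).hermitianAdj u v =
      if v - u ∈ C then if -(v - u) ∈ C then 1 else Complex.I
      else if -(v - u) ∈ C then -Complex.I else 0 := by
  by_cases h : v - u ∈ C <;> by_cases h' : -(v - u) ∈ C <;>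
    simp_all [MixedGraph.hermitianAdj, mixedCirculant, orientedPart]

/-- The sign function `σ`, extended by `0` outside `D`. -/
def extendedSign (D : Finset ℕ) (σ : {d // d ∈ D} → ℤˣ) (d : ℕ) : ℤ :=
  if h : d ∈ D then (σ ⟨d, h⟩ : ℤ) else 0

theorem extendedSign_eq_zero_iff {D : Finset ℕ} {σ : {d // d ∈ D} → ℤˣ} {d : ℕ} :
    extendedSign D σ d = 0 ↔ d ∉ D := by
  unfold extendedSign
  split_ifs with h <;> simp [h]

/-- The entry `h_{u, u + c}` of the Hermitian adjacency matrix of `imcg n B D σ`. -/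
noncomputable def imcgCoeff (n : ℕ) (B D : Finset ℕ) (σ : {d // d ∈ D} → ℤˣ) (c : ZMod n) : ℂ :=
  (if Nat.gcd c.val n ∈ B then 1 else 0) + Complex.I * ((extendedSign D σ (Nat.gcd c.val n) *
    ZMod.χ₄ ((c.val / Nat.gcd c.val n : ℕ) : ZMod 4) : ℤ) : ℂ)

theorem χ₄_neg (a : ZMod 4) : ZMod.χ₄ (-a) = -ZMod.χ₄ a := by
  revert a
  decide

theorem χ₄_natCast_eq_unit_iff (k : ℕ) (u : ℤˣ) :
    ZMod.χ₄ (k : ZMod 4) = u ↔ (k : ℤ) ≡ u [ZMOD 4] := by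
  have hχ : ∀ (a : ZMod 4) (u : ℤˣ), ZMod.χ₄ a = u ↔ a = ((u : ℤ) : ZMod 4) := by decide
  have hcast := ZMod.intCast_eq_intCast_iff (k : ℤ) (u : ℤ) 4
  rw [Int.cast_natCast] at hcast
  exact (hχ _ _).trans hcast

section Coefficients

variable {n : ℕ} {B D : Finset ℕ} {σ : {d // d ∈ D} → ℤˣ}

theorem natCast_div_eq_zero {d : ℕ} (h : 4 * d ∣ n) : ((n / d : ℕ) : ZMod 4) = 0 := by
  rw [ZMod.natCast_eq_zero_iff]
  exact Nat.dvd_div_of_mul_dvd (by rwa [mul_comm])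

theorem imcgCoeff_natCast (hD : ∀ d ∈ D, 4 * d ∣ n) (N : ℕ) :
    imcgCoeff n B D σ (N : ZMod n) = (if Nat.gcd N n ∈ B then 1 else 0) +
      Complex.I * ((extendedSign D σ (Nat.gcd N n) *
        ZMod.χ₄ ((N / Nat.gcd N n : ℕ) : ZMod 4) : ℤ) : ℂ) := by
  have hgcd : Nat.gcd (N % n) n = Nat.gcd N n := by rw [Nat.gcd_comm N, Nat.gcd_rec n N]
  rw [imcgCoeff, ZMod.val_natCast, hgcd]
  by_cases h : Nat.gcd N n ∈ D
  · have hdiv : N / Nat.gcd N n = N % n / Nat.gcd N n + n / Nat.gcd N n * (N / n) := by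
      nth_rw 1 [← Nat.mod_add_div N n]
      rw [Nat.add_div_of_dvd_left ((Nat.gcd_dvd_right N n).mul_right _),
        Nat.mul_div_right_comm (Nat.gcd_dvd_right N n)]
    rw [hdiv, Nat.cast_add, Nat.cast_mul, natCast_div_eq_zero (hD _ h), zero_mul, add_zero]
  · rw [extendedSign_eq_zero_iff.2 h, zero_mul, zero_mul]

theorem one_le_val_of_gcd_mem {A : Finset ℕ} (hA : n ∉ A) {c : ZMod n}
    (h : Nat.gcd c.val n ∈ A) : 1 ≤ c.val := by
  rw [Nat.one_le_iff_ne_zero]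
  intro hc
  rw [hc, Nat.gcd_zero_left] at h
  exact hA h

variable [NeZero n]

theorem notMem_of_four_mul_dvd (hD : ∀ d ∈ D, 4 * d ∣ n) : n ∉ D := fun h => by
  have := Nat.le_of_dvd (NeZero.pos n) (hD n h)
  have := NeZero.pos n
  lia

theorem mem_imcgSet_iff (hB : n ∉ B) (hD : ∀ d ∈ D, 4 * d ∣ n) (c : ZMod n) :
    c ∈ imcgSet n B D σ ↔ Nat.gcd c.val n ∈ B ∨ ∃ h : Nat.gcd c.val n ∈ D,
      ZMod.χ₄ ((c.val / Nat.gcd c.val n : ℕ) : ZMod 4) = σ ⟨_, h⟩ := by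
  simp only [imcgSet, Set.mem_union, Set.mem_iUnion, gcdClass, gcdClassMod, Set.mem_ofPred_eq]
  refine or_congr ⟨?_, fun h => ⟨_, h, one_le_val_of_gcd_mem hB h, rfl⟩⟩ ⟨?_, ?_⟩
  · rintro ⟨d, hd, -, rfl⟩
    exact hd
  · rintro ⟨⟨d, hd⟩, ⟨h1, rfl⟩, k, hk, hkσ⟩
    refine ⟨hd, (χ₄_natCast_eq_unit_iff _ _).2 ?_⟩
    rwa [Nat.div_eq_of_eq_mul_right (Nat.gcd_pos_of_pos_left _ h1) hk]
  · rintro ⟨h, hχ⟩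
    exact ⟨⟨_, h⟩, ⟨one_le_val_of_gcd_mem (notMem_of_four_mul_dvd hD) h, rfl⟩, _,
      (Nat.mul_div_cancel' (Nat.gcd_dvd_left _ _)).symm, (χ₄_natCast_eq_unit_iff _ _).1 hχ⟩

theorem gcd_val_neg (c : ZMod n) : Nat.gcd (-c).val n = Nat.gcd c.val n := by
  rw [ZMod.neg_val]
  split_ifs with h
  · simp [h]
  · exact Nat.gcd_self_sub_left c.val_lt.le

theorem χ₄_val_neg_div (hD : ∀ d ∈ D, 4 * d ∣ n) {c : ZMod n} (h : Nat.gcd c.val n ∈ D) :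
    ZMod.χ₄ (((-c).val / Nat.gcd c.val n : ℕ) : ZMod 4) =
      -ZMod.χ₄ ((c.val / Nat.gcd c.val n : ℕ) : ZMod 4) := by
  have hval := one_le_val_of_gcd_mem (notMem_of_four_mul_dvd hD) h
  have hc : c ≠ 0 := by
    rintro rfl
    simp at hval
  have hsum : (-c).val / Nat.gcd c.val n + c.val / Nat.gcd c.val n = n / Nat.gcd c.val n := by
    rw [← Nat.add_div_of_dvd_left (Nat.gcd_dvd_left _ _), ZMod.neg_val, if_neg hc,
      Nat.sub_add_cancel c.val_lt.le]
  rw [← χ₄_neg]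
  congr 1
  exact eq_neg_of_add_eq_zero_left (by rw [← Nat.cast_add, hsum, natCast_div_eq_zero (hD _ h)])

theorem odd_val_div_gcd (hD : ∀ d ∈ D, 4 * d ∣ n) {c : ZMod n} (h : Nat.gcd c.val n ∈ D) :
    Odd (c.val / Nat.gcd c.val n) := by
  have hg : 0 < Nat.gcd c.val n := Nat.gcd_pos_of_pos_right _ (NeZero.pos n)
  have h2 : 2 ∣ n / Nat.gcd c.val n :=
    Nat.dvd_div_of_mul_dvd ((Dvd.intro_left 2 (by ring)).trans (hD _ h))
  exact ((Nat.coprime_div_gcd_div_gcd hg).coprime_dvd_right h2).odd_of_right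

theorem hermitianAdj_imcg (hB : n ∉ B) (hD : ∀ d ∈ D, 4 * d ∣ n) (hBD : Disjoint B D)
    (u v : ZMod n) : (imcg n B D σ).hermitianAdj u v = imcgCoeff n B D σ (v - u) := by
  rw [imcg, hermitianAdj_mixedCirculant]
  generalize v - u = c
  have hneg := mem_imcgSet_iff (σ := σ) hB hD (-c)
  simp only [gcd_val_neg] at hneg
  simp only [mem_imcgSet_iff (σ := σ) hB hD c, hneg, imcgCoeff]
  by_cases hgB : Nat.gcd c.val n ∈ B
  · have hgD : Nat.gcd c.val n ∉ D := disjoint_left.1 hBD hgB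
    simp [hgB, extendedSign_eq_zero_iff.2 hgD]
  by_cases hgD : Nat.gcd c.val n ∈ D
  · simp only [hgB, extendedSign, hgD, exists_true_left, dite_true, false_or, χ₄_val_neg_div hD hgD]
    obtain hχ | hχ := χ₄_natCast_of_odd (odd_val_div_gcd hD hgD) <;>
      obtain hσ | hσ := Int.units_eq_one_or (σ ⟨_, hgD⟩) <;> simp [hχ, hσ]
  · simp [hgB, hgD, extendedSign_eq_zero_iff.2 hgD]

end Coefficients

theorem sum_zmod_mul_eq_sum_range_sum_range {M : Type*} [AddCommMonoid M] {p q : ℕ} [NeZero p]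
    [NeZero q] (hpq : p.Coprime q) (G : ZMod (p * q) → M) :
    ∑ c, G c = ∑ y ∈ range p, ∑ x ∈ range q, G ((y * q + p * x : ℕ)) := by
  have hinj : Set.InjOn (fun z : ℕ × ℕ => ((z.1 * q + p * z.2 : ℕ) : ZMod (p * q)))
      (range p ×ˢ range q : Finset (ℕ × ℕ)) := by
    rintro ⟨y, x⟩ hyx ⟨y', x'⟩ hyx' h
    simp only [coe_product, coe_range, Set.mem_prod, Set.mem_Iio] at hyx hyx'
    have hmod : y * q + p * x ≡ y' * q + p * x' [MOD p * q] :=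
      (ZMod.natCast_eq_natCast_iff _ _ _).1 h
    have hy : y * q ≡ y' * q [MOD p] := by
      simpa [Nat.ModEq, Nat.add_mul_mod_self_left] using hmod.of_mul_right q
    have hx : p * x ≡ p * x' [MOD q] := by
      simpa [Nat.ModEq, Nat.mul_add_mod_self_right] using hmod.of_mul_left p
    exact Prod.ext ((hy.cancel_right_of_coprime hpq).eq_of_lt_of_lt hyx.1 hyx'.1)
      ((hx.cancel_left_of_coprime hpq.symm).eq_of_lt_of_lt hyx.2 hyx'.2)
  rw [← sum_product']
  refine (sum_nbij _ (fun _ _ => mem_univ _) hinj ?_ fun _ _ => rfl).symm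
  exact surjOn_of_injOn_of_card_le _ (fun _ _ => mem_coe.2 (mem_univ _)) hinj (by simp [ZMod.card])

theorem gcd_mul_add_mul {p q : ℕ} (h : p.Coprime q) (y x : ℕ) :
    Nat.gcd (y * q + p * x) (p * q) = Nat.gcd y p * Nat.gcd x q := by
  rw [h.gcd_mul, Nat.gcd_add_mul_left_left, h.symm.gcd_mul_right_cancel, Nat.gcd_mul_right_add_left,
    h.gcd_mul_left_cancel]

/-- For `n = 2 ^ e * m` with `m` odd, the indicator of the `g ∣ m` with `2 ^ (e - a) * g ∈ B`, that
is, of the odd parts of the elements of `B_a`. -/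
def evenCoeff (e : ℕ) (B : Finset ℕ) (a g : ℕ) : ℤ :=
  if a ≤ e ∧ 2 ^ (e - a) * g ∈ B then 1 else 0

/-- For `n = 2 ^ e * m` with `m` odd, the sign of `2 ^ (e - a) * g`, twisted by the character modulo
`4` so that the weights of the elements of `D_a` depend on the `2`-part of the residue only through
the factor `χ₄ y` in `imcgCoeff_two_pow`. -/
def oddCoeff (e m : ℕ) (D : Finset ℕ) (σ : {d // d ∈ D} → ℤˣ) (a g : ℕ) : ℤ :=
  if a ≤ e then extendedSign D σ (2 ^ (e - a) * g) * ZMod.χ₄ ((m / g : ℕ) : ZMod 4) else 0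

section Spectrum

variable {e m : ℕ} {B D : Finset ℕ} {σ : {d // d ∈ D} → ℤˣ}

theorem two_le_of_mem (hm : Odd m) (hD : ∀ d ∈ D, 4 * d ∣ 2 ^ e * m) {a g : ℕ}
    (h : 2 ^ (e - a) * g ∈ D) : 2 ≤ a := by
  have hdvd : 2 ^ (e - a + 2) ∣ 2 ^ e * m := (Dvd.intro g (by ring)).trans (hD _ h)
  have hpow := (Nat.Coprime.pow_left _ hm.coprime_two_left).dvd_of_dvd_mul_right hdvd
  have hle := (Nat.pow_dvd_pow_iff_le_right (by norm_num)).1 hpow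
  lia

theorem oddCoeff_eq_zero_of_lt_two (hm : Odd m) (hD : ∀ d ∈ D, 4 * d ∣ 2 ^ e * m) {a : ℕ}
    (ha : a < 2) : oddCoeff e m D σ a = 0 := by
  funext g
  unfold oddCoeff
  split_ifs with hae
  · rw [extendedSign_eq_zero_iff.2 fun h => ha.not_ge (two_le_of_mem hm hD h), zero_mul,
      Pi.zero_apply]
  · rfl

theorem gcd_two_pow_mul {a y : ℕ} (ha : a ≤ e) (hy : y.Coprime (2 ^ a)) :
    Nat.gcd (2 ^ (e - a) * y) (2 ^ e) = 2 ^ (e - a) := by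
  rw [← pow_sub_mul_pow 2 ha, Nat.gcd_mul_left, hy.gcd_eq_one, mul_one]

theorem χ₄_div_two_pow_mul_gcd (hm : Odd m) {a : ℕ} (ha : a ≤ e) (h2 : 2 ≤ a) (y x : ℕ) :
    ZMod.χ₄ (((2 ^ (e - a) * y * m + 2 ^ e * x) / (2 ^ (e - a) * Nat.gcd x m) : ℕ) : ZMod 4) =
      ZMod.χ₄ (y : ZMod 4) * ZMod.χ₄ ((m / Nat.gcd x m : ℕ) : ZMod 4) := by
  have hg : 0 < Nat.gcd x m := Nat.gcd_pos_of_pos_right _ hm.pos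
  have hdiv : (2 ^ (e - a) * y * m + 2 ^ e * x) / (2 ^ (e - a) * Nat.gcd x m) =
      y * (m / Nat.gcd x m) + 4 * (2 ^ (a - 2) * (x / Nat.gcd x m)) := by
    refine Nat.div_eq_of_eq_mul_right (by positivity) ?_
    have hpow : 2 ^ e = 2 ^ (e - a) * (2 ^ (a - 2) * 2 ^ 2) := by
      rw [pow_sub_mul_pow 2 h2, pow_sub_mul_pow 2 ha]
    have hm' := (Nat.mul_div_cancel' (Nat.gcd_dvd_right x m)).symm
    have hx := (Nat.mul_div_cancel' (Nat.gcd_dvd_left x m)).symm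
    rw [hpow]
    linear_combination 2 ^ (e - a) * y * hm' + 2 ^ (e - a) * (2 ^ (a - 2) * 2 ^ 2) * hx
  have h4 : (4 : ZMod 4) = 0 := rfl
  rw [hdiv, Nat.cast_add, Nat.cast_mul 4, Nat.cast_ofNat, h4, zero_mul, add_zero, Nat.cast_mul,
    map_mul]

theorem imcgCoeff_two_pow (hm : Odd m) (hD : ∀ d ∈ D, 4 * d ∣ 2 ^ e * m) {a y : ℕ} (ha : a ≤ e)
    (hy : y.Coprime (2 ^ a)) (x : ℕ) :
    imcgCoeff (2 ^ e * m) B D σ ((2 ^ (e - a) * y * m + 2 ^ e * x : ℕ) : ZMod (2 ^ e * m)) =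
      evenCoeff e B a (Nat.gcd x m) + Complex.I * (ZMod.χ₄ (y : ZMod 4) : ℂ) *
        oddCoeff e m D σ a (Nat.gcd x m) := by
  have hcop : Nat.Coprime (2 ^ e) m := Nat.Coprime.pow_left _ hm.coprime_two_left
  rw [imcgCoeff_natCast hD, gcd_mul_add_mul hcop, gcd_two_pow_mul ha hy]
  simp only [evenCoeff, oddCoeff, ha, true_and, if_true]
  rw [mul_assoc Complex.I]
  congr 2
  · split_ifs <;> simp
  · by_cases h : 2 ^ (e - a) * Nat.gcd x m ∈ D
    · rw [χ₄_div_two_pow_mul_gcd hm ha (two_le_of_mem hm hD h)]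
      push_cast
      ring
    · rw [extendedSign_eq_zero_iff.2 h]
      simp

/-- The Fourier transform of even and odd coefficients `b a`, `k a` placed at the `2`-adic levels
`a < N`, with `m` the odd part of the modulus. -/
def layeredSpectrum (N m : ℕ) (b k : ℕ → ℕ → ℤ) (j : ℕ) : ℤ :=
  ∑ a ∈ range N, twoPowSum j (evenDFT m j (b a)) (evenDFT m j (k a)) a

theorem stdAddChar_two_pow_mul_add [NeZero m] {a : ℕ} (ha : a ≤ e) (y x j : ℕ) :
    ZMod.stdAddChar (((2 ^ (e - a) * y * m + 2 ^ e * x : ℕ) : ZMod (2 ^ e * m)) *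
        (j : ZMod (2 ^ e * m))) =
      ZMod.stdAddChar ((y * j : ℕ) : ZMod (2 ^ a)) * ZMod.stdAddChar ((x * j : ℕ) : ZMod m) := by
  have hN : 2 ^ e * m = 2 ^ (e - a) * m * 2 ^ a := by
    rw [← pow_sub_mul_pow 2 ha]
    ring
  rw [← stdAddChar_natCast_mul hN, ← stdAddChar_natCast_mul (N := 2 ^ e * m) rfl,
    ← AddChar.map_add_eq_mul, ← Nat.cast_mul, ← Nat.cast_add]
  congr 2
  ring

theorem sum_imcgCoeff_mul_stdAddChar [NeZero m] (hm : Odd m) (hD : ∀ d ∈ D, 4 * d ∣ 2 ^ e * m)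
    (j : ℕ) :
    ∑ c, imcgCoeff (2 ^ e * m) B D σ c * ZMod.stdAddChar (c * (j : ZMod (2 ^ e * m))) =
      layeredSpectrum (e + 1) m (evenCoeff e B) (oddCoeff e m D σ) j := by
  have hodd (a : ℕ) (y : ℕ) (ha : a ≤ e) (hy : y.Coprime (2 ^ a)) :
      ∑ x ∈ range m, imcgCoeff (2 ^ e * m) B D σ
          ((2 ^ (e - a) * y * m + 2 ^ e * x : ℕ) : ZMod (2 ^ e * m)) *
        ZMod.stdAddChar (((2 ^ (e - a) * y * m + 2 ^ e * x : ℕ) : ZMod (2 ^ e * m)) *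
          (j : ZMod (2 ^ e * m))) =
      (evenDFT m j (evenCoeff e B a) + Complex.I * ZMod.χ₄ y * evenDFT m j (oddCoeff e m D σ a)) *
        ZMod.stdAddChar ((y * j : ℕ) : ZMod (2 ^ a)) := by
    rw [← sum_range_gcd_mul_stdAddChar, ← sum_range_gcd_mul_stdAddChar, mul_sum,
      ← sum_add_distrib, sum_mul]
    refine sum_congr rfl fun x _ => ?_
    rw [imcgCoeff_two_pow hm hD ha hy, stdAddChar_two_pow_mul_add ha]
    ring
  rw [sum_zmod_mul_eq_sum_range_sum_range (Nat.Coprime.pow_left _ hm.coprime_two_left),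
    sum_range_two_pow, layeredSpectrum, Int.cast_sum]
  refine sum_congr rfl fun a ha => ?_
  rw [← sum_range_coprime_two_pow]
  · exact sum_congr rfl fun y hy =>
      hodd a y (Nat.lt_succ_iff.1 (mem_range.1 ha)) (mem_filter.1 hy).2
  · rintro rfl
    rw [oddCoeff_eq_zero_of_lt_two hm hD one_lt_two, map_zero]

end Spectrum

theorem twoPowSum_zero_zero (j a : ℕ) : twoPowSum j 0 0 a = 0 := by
  obtain _ | _ | a := a <;> simp [twoPowSum]

theorem twoPowSum_eq_zero {j a : ℕ} (ha : 4 ≤ a) (hj : ¬ 4 ∣ j) (β κ : ℤ) :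
    twoPowSum j β κ a = 0 := by
  obtain ⟨a, rfl⟩ := Nat.exists_eq_add_of_le' ha
  exact if_neg fun h => hj ((pow_dvd_pow 2 (Nat.le_add_left 2 a)).trans h)

theorem eight_dvd_twoPowSum {a : ℕ} (ha : 4 ≤ a) (j : ℕ) (β κ : ℤ) : 8 ∣ twoPowSum j β κ a := by
  obtain ⟨a, rfl⟩ := Nat.exists_eq_add_of_le' ha
  rw [twoPowSum]
  split_ifs
  · exact Dvd.dvd.mul_right (pow_dvd_pow (2 : ℤ) (Nat.le_add_left 3 a)) _
  · exact dvd_zero _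

section LayeredSpectrum

variable {N m : ℕ} {b k : ℕ → ℕ → ℤ}

theorem layeredSpectrum_eq_of_le {N' : ℕ} (hN : N ≤ N') (hb : ∀ a, N ≤ a → b a = 0)
    (hk : ∀ a, N ≤ a → k a = 0) : layeredSpectrum N m b k = layeredSpectrum N' m b k := by
  funext j
  refine sum_subset (range_subset_range.2 hN) fun a _ ha => ?_
  have haN : N ≤ a := not_lt.1 fun h => ha (mem_range.2 h)
  rw [hb a haN, hk a haN, map_zero, twoPowSum_zero_zero]

theorem layeredSpectrum_add_four (N m : ℕ) (b k : ℕ → ℕ → ℤ) (j : ℕ) :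
    layeredSpectrum (N + 4) m b k j =
      layeredSpectrum 4 m b k j +
        ∑ a ∈ range N, twoPowSum j (evenDFT m j (b (4 + a))) (evenDFT m j (k (4 + a))) (4 + a) := by
  rw [layeredSpectrum, add_comm N, sum_range_add, layeredSpectrum]

theorem layeredSpectrum_eq_of_not_four_dvd {j : ℕ} (hj : ¬ 4 ∣ j) :
    layeredSpectrum (N + 4) m b k j = layeredSpectrum 4 m b k j := by
  rw [layeredSpectrum_add_four, sum_eq_zero, add_zero]
  exact fun a _ => twoPowSum_eq_zero (Nat.le_add_right 4 a) hj _ _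

theorem layeredSpectrum_modEq_eight (j : ℕ) :
    layeredSpectrum (N + 4) m b k j ≡ layeredSpectrum 4 m b k j [ZMOD 8] := by
  rw [layeredSpectrum_add_four]
  exact Int.add_modEq_left_iff.2
    (dvd_sum fun a _ => eight_dvd_twoPowSum (Nat.le_add_right 4 a) _ _ _)

theorem layeredSpectrum_of_odd {j : ℕ} (hj : Odd j) :
    layeredSpectrum (N + 4) m b k j =
      evenDFT m j (b 0) - evenDFT m j (b 1) - 2 * ZMod.χ₄ j * evenDFT m j (k 2) := by
  have hj2 := Nat.odd_iff.1 hj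
  have hχ : ZMod.χ₄ ((j + 1 : ℕ) : ZMod 4) = 0 := χ₄_natCast_of_even hj.add_one
  have h2 : ¬ 2 ∣ j := by lia
  rw [layeredSpectrum_eq_of_not_four_dvd (by lia)]
  simp only [layeredSpectrum, sum_range_succ, range_zero, sum_empty, twoPowSum, pow_zero, one_dvd,
    if_true, Nat.div_one, hχ, pow_one, h2, if_false, hj.neg_one_pow]
  ring

theorem layeredSpectrum_two_mul {q : ℕ} (hq : Odd q) :
    layeredSpectrum (N + 4) m b k (2 * q) =
      evenDFT m (2 * q) (b 0) + evenDFT m (2 * q) (b 1) - 2 * evenDFT m (2 * q) (b 2) -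
        4 * ZMod.χ₄ q * evenDFT m (2 * q) (k 3) := by
  have hq2 := Nat.odd_iff.1 hq
  have hχ : ZMod.χ₄ ((2 * q + 1 : ℕ) : ZMod 4) = -1 := ZMod.χ₄_nat_three_mod_four (by lia)
  have hχ' : ZMod.χ₄ ((2 * q : ℕ) : ZMod 4) = 0 := χ₄_natCast_of_even (even_two_mul q)
  have hχ'' : ZMod.χ₄ ((q + 1 : ℕ) : ZMod 4) = 0 := χ₄_natCast_of_even hq.add_one
  rw [layeredSpectrum_eq_of_not_four_dvd (by lia)]
  simp only [layeredSpectrum, sum_range_succ, range_zero, sum_empty, twoPowSum, pow_zero, one_dvd,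
    if_true, Nat.div_one, hχ, hχ', hχ'', pow_one, dvd_mul_right, Nat.mul_div_cancel_left _ two_pos,
    (even_two_mul q).neg_one_pow]
  ring

theorem layeredSpectrum_four_mul_modEq (q : ℕ) :
    layeredSpectrum (N + 4) m b k (4 * q) ≡
      evenDFT m (4 * q) (b 0) + evenDFT m (4 * q) (b 1) + 2 * evenDFT m (4 * q) (b 2) +
        4 * evenDFT m (4 * q) (b 3) [ZMOD 8] := by
  have hχ : ZMod.χ₄ ((4 * q + 1 : ℕ) : ZMod 4) = 1 := ZMod.χ₄_nat_one_mod_four (by lia)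
  have hχ' : ZMod.χ₄ ((4 * q : ℕ) : ZMod 4) = 0 :=
    χ₄_natCast_of_even (even_iff_two_dvd.2 (by lia))
  have hχ'' : ZMod.χ₄ ((2 * q : ℕ) : ZMod 4) = 0 := χ₄_natCast_of_even (even_two_mul q)
  have hdiv : 4 * q / 2 = 2 * q := by lia
  have h2 : 2 ∣ 4 * q := by lia
  have hodd := χ₄_natCast_of_odd (odd_two_mul_add_one q)
  refine layeredSpectrum_modEq_eight (4 * q) |>.trans ?_
  simp only [layeredSpectrum, sum_range_succ, range_zero, sum_empty, twoPowSum, pow_zero, one_dvd,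
    if_true, Nat.div_one, hχ, hχ', hχ'', hdiv, pow_one, h2,
    Even.neg_one_pow (even_iff_two_dvd.2 h2)]
  obtain hχ3 | hχ3 := hodd <;> rw [hχ3] <;> exact Int.modEq_iff_dvd.2 (by lia)

end LayeredSpectrum

section LevelCondition

variable {N m : ℕ} {b k : ℕ → ℕ → ℤ} {v : ℕ}

theorem evenDFT_eq_add_of_eqOn_properDivisors [NeZero m] {h h' : ℕ → ℤ}
    (hh : ∀ g ∈ m.properDivisors, h g = h' g) (w : ℕ) :
    evenDFT m w h = evenDFT m w h' + (h m - h' m) := by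
  have hsub := evenDFT_eq_self (h := h - h') (fun g hg => sub_eq_zero.2 (hh g hg)) w
  rw [map_sub] at hsub
  exact eq_add_of_sub_eq' hsub

theorem exists_modEq_eight_modEq (hm : Odd m) (r w : ℕ) :
    ∃ j, j ≡ r [MOD 8] ∧ j ≡ w [MOD m] :=
  let ⟨j, hj⟩ := Nat.chineseRemainder (Nat.Coprime.pow_left 3 hm.coprime_two_left) r w
  ⟨j, hj⟩

theorem isCoprime_two_pow_natCast (hm : Odd m) (v : ℕ) : IsCoprime ((2 : ℤ) ^ v) m := by
  exact_mod_cast Nat.isCoprime_iff_coprime.2 (hm.coprime_two_left.pow_left v)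

section Alternates

variable (hΛ : AlternatesTwoAdically (layeredSpectrum (N + 4) m b k) v)
include hΛ

theorem evenDFT_modEq_of_odd (hm : Odd m) (u : ℤˣ) (w : ℕ) :
    evenDFT m w (b 0 - b 1 - (2 * u : ℤ) • k 2) ≡
      layeredSpectrum (N + 4) m b k 0 + 2 ^ v [ZMOD 2 ^ (v + 1)] := by
  obtain ⟨r, hr⟩ : ∃ r : ℕ, (r : ℤ) ≡ u [ZMOD 4] := by
    obtain rfl | rfl := Int.units_eq_one_or u
    exacts [⟨1, rfl⟩, ⟨3, rfl⟩]
  obtain ⟨j, hj8, hjw⟩ := exists_modEq_eight_modEq hm r w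
  have hj4 : (j : ℤ) ≡ u [ZMOD 4] :=
    (Int.natCast_modEq_iff.2 (hj8.of_dvd (by norm_num))).trans hr
  have hju := (χ₄_natCast_eq_unit_iff j u).2 hj4
  have hj : Odd j := Nat.not_even_iff_odd.1 fun h => u.ne_zero (by rw [← hju, χ₄_natCast_of_even h])
  have hspec := layeredSpectrum_of_odd (N := N) (m := m) (b := b) (k := k) hj
  rw [hju, evenDFT_congr m hjw] at hspec
  rw [map_sub, map_sub, map_smul, smul_eq_mul, ← hspec]
  refine (hΛ j).trans ?_
  obtain ⟨t, rfl⟩ := hj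
  exact Int.modEq_iff_dvd.2 ⟨-t, by push_cast; ring⟩

theorem evenDFT_modEq_of_two_mul_odd (hm : Odd m) (w : ℕ) :
    evenDFT m w (b 0 + b 1 - (2 : ℤ) • b 2 - (4 : ℤ) • k 3) ≡
      layeredSpectrum (N + 4) m b k 0 [ZMOD 2 ^ (v + 1)] := by
  obtain ⟨j, hj8, hjw⟩ := exists_modEq_eight_modEq hm 2 w
  obtain ⟨q, rfl⟩ : 2 ∣ j := (hj8.dvd_iff (by norm_num)).2 dvd_rfl
  have hq : q % 4 = 1 := by
    rw [Nat.ModEq] at hj8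
    lia
  have hspec := layeredSpectrum_two_mul (N := N) (m := m) (b := b) (k := k)
    (Nat.odd_iff.2 (Nat.odd_of_mod_four_eq_one hq))
  rw [ZMod.χ₄_nat_one_mod_four hq, evenDFT_congr m hjw, mul_one] at hspec
  simp only [map_sub, map_add, map_smul, smul_eq_mul, ← hspec]
  refine (hΛ (2 * q)).trans (Int.modEq_iff_dvd.2 ⟨-q, by push_cast; ring⟩)

theorem evenDFT_modEq_of_four_dvd (hm : Odd m) (hv : 2 ≤ v) (w : ℕ) :
    evenDFT m w (b 0 + b 1 + (2 : ℤ) • b 2 + (4 : ℤ) • b 3) ≡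
      layeredSpectrum (N + 4) m b k 0 [ZMOD 8] := by
  obtain ⟨j, hj8, hjw⟩ := exists_modEq_eight_modEq hm 0 w
  obtain ⟨q, rfl⟩ : 4 ∣ j := (hj8.dvd_iff (by norm_num)).2 (dvd_zero 4)
  have hspec := layeredSpectrum_four_mul_modEq (N := N) (m := m) (b := b) (k := k) q
  rw [evenDFT_congr m hjw] at hspec
  simp only [map_add, map_smul, smul_eq_mul]
  refine hspec.symm.trans (((hΛ (4 * q)).of_dvd (pow_dvd_pow 2 (Nat.succ_le_succ hv))).trans ?_)
  have h8 : (8 : ℤ) ∣ 2 ^ v * ((4 * q : ℕ) : ℤ) := by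
    obtain ⟨t, rfl⟩ := Nat.exists_eq_add_of_le' hv
    exact ⟨2 ^ t * 2 * q, by push_cast; ring⟩
  exact Int.add_modEq_left_iff.2 h8

theorem one_le_of_alternates (hm : Odd m) : 1 ≤ v := by
  have hodd := evenDFT_modEq_of_odd hΛ hm 1 0
  have htwo := evenDFT_modEq_of_two_mul_odd hΛ hm 0
  by_contra! hv
  obtain rfl := Nat.lt_one_iff.1 hv
  simp only [map_sub, map_add, map_smul, smul_eq_mul, Units.val_one, pow_zero, zero_add,
    pow_one, Int.ModEq] at hodd htwo
  lia

theorem eqOn_properDivisors_of_alternates (hm : Odd m) (hb : ∀ a g, b a g = 0 ∨ b a g = 1)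
    (hk : ∀ a g, |k a g| ≤ 1) {g : ℕ} (hg : g ∈ m.properDivisors) :
    b 0 g = b 1 g ∧ b 1 g = b 2 g ∧ k 2 g = 0 := by
  have : NeZero m := ⟨hm.pos.ne'⟩
  have hcop := isCoprime_two_pow_natCast hm (v + 1)
  have h4 : (4 : ℤ) ∣ 2 ^ (v + 1) :=
    pow_dvd_pow 2 (Nat.succ_le_succ (one_le_of_alternates hΛ hm))
  have hpos := h4.trans (dvd_of_forall_evenDFT_modEq hcop (evenDFT_modEq_of_odd hΛ hm 1) hg)
  have htwo := h4.trans (dvd_of_forall_evenDFT_modEq hcop (evenDFT_modEq_of_two_mul_odd hΛ hm) hg)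
  have hk2 := abs_le.1 (hk 2 g)
  have hb0 := hb 0 g
  have hb1 := hb 1 g
  have hb2 := hb 2 g
  simp only [Pi.sub_apply, Pi.add_apply, Pi.smul_apply, smul_eq_mul, Units.val_one] at hpos htwo
  lia

theorem eqOn_properDivisors_of_alternates_of_two_le (hm : Odd m)
    (hb : ∀ a g, b a g = 0 ∨ b a g = 1) (hk : ∀ a g, |k a g| ≤ 1) (hv : 2 ≤ v) {g : ℕ}
    (hg : g ∈ m.properDivisors) : k 3 g = 0 ∧ b 2 g = b 3 g := by
  have : NeZero m := ⟨hm.pos.ne'⟩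
  obtain ⟨h01, h12, -⟩ := eqOn_properDivisors_of_alternates hΛ hm hb hk hg
  have h8 : (8 : ℤ) ∣ 2 ^ (v + 1) := pow_dvd_pow 2 (Nat.succ_le_succ hv)
  have htwo := h8.trans (dvd_of_forall_evenDFT_modEq (isCoprime_two_pow_natCast hm (v + 1))
    (evenDFT_modEq_of_two_mul_odd hΛ hm) hg)
  have hfour := dvd_of_forall_evenDFT_modEq (isCoprime_two_pow_natCast hm 3)
    (evenDFT_modEq_of_four_dvd hΛ hm hv) hg
  have hk3 := abs_le.1 (hk 3 g)
  have hb2 := hb 2 g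
  have hb3 := hb 3 g
  simp only [Pi.sub_apply, Pi.add_apply, Pi.smul_apply, smul_eq_mul] at htwo hfour
  lia

theorem two_pow_dvd_of_alternates (hm : Odd m) (hb : ∀ a g, b a g = 0 ∨ b a g = 1)
    (hk : ∀ a g, |k a g| ≤ 1) (hb0 : b 0 m = 0) :
    2 ^ (v + 1) ∣ 4 * k 2 m ∧
      2 ^ (v + 1) ∣ 2 * (b 1 m - b 2 m + k 2 m) - 4 * evenDFT m 0 (k 3) + 2 ^ v := by
  have : NeZero m := ⟨hm.pos.ne'⟩
  have hproper {g : ℕ} (hg : g ∈ m.properDivisors) :=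
    eqOn_properDivisors_of_alternates hΛ hm hb hk hg
  have hT1 := evenDFT_eq_add_of_eqOn_properDivisors (fun g hg => (hproper hg).1.symm) 0
  have hT2 := evenDFT_eq_add_of_eqOn_properDivisors (fun g hg => (hproper hg).2.1.symm) 0
  have hT2' := evenDFT_eq_self (fun g hg => (hproper hg).2.2) 0
  have hpos := evenDFT_modEq_of_odd hΛ hm 1 0
  have hneg := evenDFT_modEq_of_odd hΛ hm (-1) 0
  have htwo := evenDFT_modEq_of_two_mul_odd hΛ hm 0
  simp only [map_sub, map_add, map_smul, smul_eq_mul, hT1, hT2, hT2', hb0, Units.val_neg,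
    Units.val_one] at hpos hneg htwo
  constructor
  · convert (hpos.trans hneg.symm).dvd using 1
    ring
  · convert (hpos.trans (htwo.symm.add_right _)).dvd using 1
    ring

theorem le_two_of_alternates (hm : Odd m) (hb : ∀ a g, b a g = 0 ∨ b a g = 1)
    (hk : ∀ a g, |k a g| ≤ 1) (hb0 : b 0 m = 0) : v ≤ 2 := by
  by_contra! hv
  have : NeZero m := ⟨hm.pos.ne'⟩
  obtain ⟨hκ, hsum⟩ := two_pow_dvd_of_alternates hΛ hm hb hk hb0
  rw [evenDFT_eq_self fun g hg =>
    (eqOn_properDivisors_of_alternates_of_two_le hΛ hm hb hk hv.le hg).1] at hsum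
  have hκ2 := abs_le.1 (hk 2 m)
  have hκ3 := abs_le.1 (hk 3 m)
  have hβ1 := hb 1 m
  have hβ2 := hb 2 m
  have h16 : (16 : ℤ) ∣ 2 ^ (v + 1) := pow_dvd_pow 2 (Nat.succ_le_succ hv)
  have h8 : (8 : ℤ) ∣ 2 ^ v := pow_dvd_pow 2 hv
  have hzero : 2 * (b 1 m - b 2 m + k 2 m) - 4 * k 3 m = 0 := by
    have hκ16 := h16.trans hκ
    have hsum16 := h16.trans hsum
    lia
  rw [hzero, zero_add] at hsum
  have hpos : (0 : ℤ) < 2 ^ v := by positivity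
  have hle := Int.le_of_dvd hpos hsum
  rw [pow_succ] at hle
  linarith

end Alternates

/-- The condition, on the even and odd coefficients of levels `1`, `2`, `3` with respect to the odd
part `m` of the modulus, under which the layered spectrum alternates `2`-adically. -/
def LevelCondition (m : ℕ) (b k : ℕ → ℕ → ℤ) : Prop :=
  (∀ g ∈ m.properDivisors, b 0 g = b 1 g ∧ b 1 g = b 2 g ∧ k 2 g = 0) ∧
    ((k 2 m ≠ 0 ∧ b 1 m = 0) ∨ (k 2 m = 0 ∧ b 1 m ≠ b 2 m) ∨
      (k 2 m = 0 ∧ b 1 m = 1 ∧ b 2 m = 1 ∧ k 3 m ≠ 0 ∧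
        ∀ g ∈ m.properDivisors, k 3 g = 0 ∧ b 2 g = b 3 g))

theorem levelCondition_of_alternates (hm : Odd m) (hb : ∀ a g, b a g = 0 ∨ b a g = 1)
    (hk : ∀ a g, |k a g| ≤ 1) (hbk : ∀ a g, k a g ≠ 0 → b a g = 0) (hb0 : b 0 m = 0)
    (hΛ : AlternatesTwoAdically (layeredSpectrum (N + 4) m b k) v) : LevelCondition m b k := by
  have : NeZero m := ⟨hm.pos.ne'⟩
  have hproper {g : ℕ} (hg : g ∈ m.properDivisors) :=
    eqOn_properDivisors_of_alternates hΛ hm hb hk hg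
  obtain ⟨hκ, hsum⟩ := two_pow_dvd_of_alternates hΛ hm hb hk hb0
  have hκ2 := abs_le.1 (hk 2 m)
  have hβ1 := hb 1 m
  have hβ2 := hb 2 m
  refine ⟨fun g hg => hproper hg, ?_⟩
  obtain rfl | rfl : v = 1 ∨ v = 2 := by
    have := one_le_of_alternates hΛ hm
    have := le_two_of_alternates hΛ hm hb hk hb0
    lia
  · by_cases hκ0 : k 2 m = 0
    · exact Or.inr (Or.inl ⟨hκ0, by lia⟩)
    · have := hbk 2 m hκ0
      exact Or.inl ⟨hκ0, by lia⟩
  · have hproper' {g : ℕ} (hg : g ∈ m.properDivisors) :=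
      eqOn_properDivisors_of_alternates_of_two_le hΛ hm hb hk le_rfl hg
    have hfour := evenDFT_modEq_of_four_dvd hΛ hm le_rfl 0
    have hpos := evenDFT_modEq_of_odd hΛ hm 1 0
    have hT1 := evenDFT_eq_add_of_eqOn_properDivisors (fun g hg => (hproper hg).1.symm) 0
    have hT2 := evenDFT_eq_add_of_eqOn_properDivisors (fun g hg => (hproper hg).2.1.symm) 0
    have hT3 := evenDFT_eq_add_of_eqOn_properDivisors (fun g hg => (hproper' hg).2.symm) 0
    have hT2' := evenDFT_eq_self (fun g hg => (hproper hg).2.2) 0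
    rw [evenDFT_eq_self fun g hg => (hproper' hg).1] at hsum
    have hκ3 : k 3 m ≠ 0 := by lia
    have hβ3 := hbk 3 m hκ3
    have hκ0 : k 2 m = 0 := by lia
    have hβ12 : b 1 m = b 2 m := by lia
    simp only [map_add, map_sub, map_smul, smul_eq_mul, hT1, hT2, hT3, hT2', hb0, hβ3,
      Units.val_one, Int.modEq_iff_dvd] at hfour hpos
    exact Or.inr (Or.inr ⟨hκ0, by omega, by omega, hκ3, fun g hg => hproper' hg⟩)

theorem alternates_one (hm : Odd m) (hb0 : b 0 m = 0)
    (hproper : ∀ g ∈ m.properDivisors, b 0 g = b 1 g ∧ b 1 g = b 2 g ∧ k 2 g = 0)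
    (hodd : Odd (b 1 m + b 2 m + k 2 m)) :
    AlternatesTwoAdically (layeredSpectrum (N + 4) m b k) 1 := by
  have : NeZero m := ⟨hm.pos.ne'⟩
  have hT1 := evenDFT_eq_add_of_eqOn_properDivisors fun g hg => (hproper g hg).1.symm
  have hT2 := evenDFT_eq_add_of_eqOn_properDivisors fun g hg => (hproper g hg).2.1.symm
  have hT2' := evenDFT_eq_self fun g hg => (hproper g hg).2.2
  have hfour (q : ℕ) := (layeredSpectrum_four_mul_modEq (N := N) (m := m) (b := b) (k := k) q).dvd
  simp only [hT2, hT1, hb0] at hfour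
  have hzero := hfour 0
  rw [mul_zero] at hzero
  obtain ⟨t, ht⟩ := hodd
  intro j
  rw [Int.modEq_iff_dvd]
  obtain ⟨q, rfl | rfl⟩ := Nat.even_or_odd' j
  · obtain ⟨r, rfl | rfl⟩ := Nat.even_or_odd' q
    · have hr := hfour r
      rw [show 2 * (2 * r) = 4 * r by ring]
      omega
    · rw [layeredSpectrum_two_mul (odd_two_mul_add_one r), hT2, hT1, hb0]
      obtain hχ | hχ := χ₄_natCast_of_odd (odd_two_mul_add_one r) <;> rw [hχ] <;> omega
  · rw [layeredSpectrum_of_odd (odd_two_mul_add_one q), hT1, hT2', hb0]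
    obtain hχ | hχ := χ₄_natCast_of_odd (odd_two_mul_add_one q) <;> rw [hχ] <;> omega

theorem alternates_two (hm : Odd m) (hb0 : b 0 m = 0)
    (hproper : ∀ g ∈ m.properDivisors, b 0 g = b 1 g ∧ b 1 g = b 2 g ∧ k 2 g = 0)
    (hproper' : ∀ g ∈ m.properDivisors, k 3 g = 0 ∧ b 2 g = b 3 g)
    (hβ1 : b 1 m = 1) (hβ2 : b 2 m = 1) (hβ3 : b 3 m = 0) (hκ2 : k 2 m = 0) (hκ3 : Odd (k 3 m)) :
    AlternatesTwoAdically (layeredSpectrum (N + 4) m b k) 2 := by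
  have : NeZero m := ⟨hm.pos.ne'⟩
  have hT1 := evenDFT_eq_add_of_eqOn_properDivisors fun g hg => (hproper g hg).1.symm
  have hT2 := evenDFT_eq_add_of_eqOn_properDivisors fun g hg => (hproper g hg).2.1.symm
  have hT3 := evenDFT_eq_add_of_eqOn_properDivisors fun g hg => (hproper' g hg).2.symm
  have hT2' := evenDFT_eq_self fun g hg => (hproper g hg).2.2
  have hT3' := evenDFT_eq_self fun g hg => (hproper' g hg).1
  have hfour (q : ℕ) := (layeredSpectrum_four_mul_modEq (N := N) (m := m) (b := b) (k := k) q).dvd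
  simp only [hT3, hT2, hT1, hb0, hβ1, hβ2, hβ3] at hfour
  have hzero := hfour 0
  rw [mul_zero] at hzero
  obtain ⟨t, ht⟩ := hκ3
  intro j
  rw [Int.modEq_iff_dvd]
  obtain ⟨q, rfl | rfl⟩ := Nat.even_or_odd' j
  · obtain ⟨r, rfl | rfl⟩ := Nat.even_or_odd' q
    · have hr := hfour r
      rw [show 2 * (2 * r) = 4 * r by ring]
      omega
    · rw [layeredSpectrum_two_mul (odd_two_mul_add_one r), hT2, hT1, hT3', hb0, hβ1, hβ2, ht]
      obtain hχ | hχ := χ₄_natCast_of_odd (odd_two_mul_add_one r) <;> rw [hχ] <;> omega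
  · rw [layeredSpectrum_of_odd (odd_two_mul_add_one q), hT1, hT2', hb0, hβ1, hκ2]
    omega

theorem exists_alternates_iff_levelCondition (hm : Odd m)
    (hb : ∀ a g, b a g = 0 ∨ b a g = 1) (hk : ∀ a g, |k a g| ≤ 1)
    (hbk : ∀ a g, k a g ≠ 0 → b a g = 0) (hb0 : b 0 m = 0) :
    (∃ v, AlternatesTwoAdically (layeredSpectrum (N + 4) m b k) v) ↔ LevelCondition m b k := by
  refine ⟨fun ⟨v, hΛ⟩ => levelCondition_of_alternates hm hb hk hbk hb0 hΛ, ?_⟩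
  rintro ⟨hproper, h⟩
  have hκ2 := abs_le.1 (hk 2 m)
  have hκ3 := abs_le.1 (hk 3 m)
  have hβ1 := hb 1 m
  have hβ2 := hb 2 m
  have hβκ := hbk 2 m
  obtain h | h | ⟨h2, h1, h2', h3, hproper'⟩ := h
  · exact ⟨1, alternates_one hm hb0 hproper (by rw [Int.odd_iff]; lia)⟩
  · exact ⟨1, alternates_one hm hb0 hproper (by rw [Int.odd_iff]; lia)⟩
  · exact ⟨2, alternates_two hm hb0 hproper hproper' h1 h2' (hbk 3 m h3) h2
      (by rw [Int.odd_iff]; lia)⟩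

end LevelCondition

section OddParts

variable {e m : ℕ} {A B D : Finset ℕ} {σ : {d // d ∈ D} → ℤˣ}

theorem evenCoeff_eq_zero_or_one (e : ℕ) (B : Finset ℕ) (a g : ℕ) :
    evenCoeff e B a g = 0 ∨ evenCoeff e B a g = 1 :=
  (ite_eq_or_eq _ _ _).symm

theorem abs_oddCoeff_le_one (e m : ℕ) (σ : {d // d ∈ D} → ℤˣ) (a g : ℕ) :
    |oddCoeff e m D σ a g| ≤ 1 := by
  have hχ : ∀ x : ZMod 4, |ZMod.χ₄ x| ≤ 1 := by decide
  unfold oddCoeff extendedSign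
  split_ifs with h hD
  · rw [abs_mul, Int.isUnit_iff_abs_eq.1 (Units.isUnit _), one_mul]
    exact hχ _
  all_goals norm_num

theorem evenCoeff_eq_zero_of_oddCoeff_ne_zero (hBD : Disjoint B D) {a g : ℕ}
    (h : oddCoeff e m D σ a g ≠ 0) : evenCoeff e B a g = 0 := by
  have hD : 2 ^ (e - a) * g ∈ D := by
    by_contra hD
    simp [oddCoeff, extendedSign_eq_zero_iff.2 hD] at h
  exact if_neg fun hB => disjoint_left.1 hBD hB.2 hD

theorem forall_hasPST_imcg_iff [NeZero (2 ^ e * m)] (he : e ≠ 0) (hm : Odd m)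
    (hB : 2 ^ e * m ∉ B) (hD : ∀ d ∈ D, 4 * d ∣ 2 ^ e * m) (hBD : Disjoint B D) :
    (∀ b : ZMod (2 ^ e * m), (imcg (2 ^ e * m) B D σ).HasPST
        (b + ((2 ^ e * m / 2 : ℕ) : ZMod (2 ^ e * m))) b) ↔
      LevelCondition m (evenCoeff e B) (oddCoeff e m D σ) := by
  have : NeZero m := ⟨hm.pos.ne'⟩
  have hn : Even (2 ^ e * m) := ((Nat.even_pow' he).2 even_two).mul_right m
  have hb (a : ℕ) (ha : e + 1 ≤ a) : evenCoeff e B a = 0 :=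
    funext fun _ => if_neg fun h => ha.not_gt (Nat.lt_succ_of_le h.1)
  have hk (a : ℕ) (ha : e + 1 ≤ a) : oddCoeff e m D σ a = 0 :=
    funext fun _ => if_neg fun h => ha.not_gt (Nat.lt_succ_of_le h)
  rw [forall_hasPST_iff hn _ _ (hermitianAdj_imcg hB hD hBD) _ (sum_imcgCoeff_mul_stdAddChar hm hD),
    exists_time_iff, layeredSpectrum_eq_of_le (Nat.le_add_right (e + 1) 3) hb hk,
    exists_alternates_iff_levelCondition hm (evenCoeff_eq_zero_or_one e B)
      (abs_oddCoeff_le_one e m σ) fun _ _ => evenCoeff_eq_zero_of_oddCoeff_ne_zero hBD]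
  exact if_neg fun h => hB h.2

/-- The odd parts `g` of the elements `2 ^ (e - a) * g` of the layer `A_a`, for a set `A` of
divisors of `2 ^ e * m` with `m` odd. -/
def oddParts (e m : ℕ) (A : Finset ℕ) (a : ℕ) : Finset ℕ :=
  {g ∈ m.divisors | a ≤ e ∧ 2 ^ (e - a) * g ∈ A}

theorem oddParts_eq_empty_of_lt {a : ℕ} (ha : e < a) : oddParts e m A a = ∅ :=
  filter_eq_empty_iff.2 fun _ _ h => ha.not_ge h.1

theorem two_pow_mul_div_two_pow {a : ℕ} (ha : a ≤ e) : 2 ^ e * m / 2 ^ a = 2 ^ (e - a) * m := by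
  rw [← Nat.pow_div ha two_pos, Nat.div_mul_right_comm (pow_dvd_pow 2 ha)]

theorem self_mem_oddParts_iff (hm : m ≠ 0) {a : ℕ} (ha : a ≤ e) :
    m ∈ oddParts e m A a ↔ 2 ^ e * m / 2 ^ a ∈ A := by
  simp [oddParts, hm, ha, two_pow_mul_div_two_pow ha]

theorem exists_mem_oddParts (hm : m ≠ 0) {d : ℕ} (hdA : d ∈ A) (hd : d ∣ 2 ^ e * m) :
    ∃ a ≤ e, ∃ g ∈ oddParts e m A a, 2 ^ (e - a) * g = d := by
  obtain ⟨y, g, hy, hg, rfl⟩ := Nat.dvd_mul.1 hd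
  obtain ⟨k, hk, rfl⟩ := (Nat.dvd_prime_pow Nat.prime_two).1 hy
  have hka := Nat.sub_sub_self hk
  refine ⟨e - k, Nat.sub_le e k, g, mem_filter.2 ⟨Nat.mem_divisors.2 ⟨hg, hm⟩, ?_⟩, by rw [hka]⟩
  exact ⟨Nat.sub_le e k, by rwa [hka]⟩

theorem padicValNat_two_pow_mul_div (hm : Odd m) {k g : ℕ} (hk : k ≤ e) (hg : g ∣ m) :
    padicValNat 2 (2 ^ e * m / (2 ^ k * g)) = e - k := by
  have hodd := hm.of_dvd_nat (Nat.div_dvd_of_dvd hg)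
  rw [Nat.mul_div_mul_comm (pow_dvd_pow 2 hk) hg, Nat.pow_div hk two_pos,
    padicValNat.mul (by positivity) hodd.pos.ne', padicValNat.prime_pow,
    padicValNat.eq_zero_of_not_dvd hodd.not_two_dvd_nat, add_zero]

theorem layer_two_pow_mul (hm : Odd m) (hA : ∀ d ∈ A, d ∣ 2 ^ e * m) (a : ℕ) :
    layer (2 ^ e * m) A a = dilate (2 ^ (e - a)) (oddParts e m A a) := by
  have hval {a g : ℕ} (hg : g ∈ oddParts e m A a) :
      padicValNat 2 (2 ^ e * m / (2 ^ (e - a) * g)) = a := by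
    obtain ⟨hgm, ha, -⟩ := mem_filter.1 hg
    rw [padicValNat_two_pow_mul_div hm (Nat.sub_le e a) (Nat.dvd_of_mem_divisors hgm),
      Nat.sub_sub_self ha]
  ext d
  rw [layer, dilate, mem_filter, mem_image]
  constructor
  · rintro ⟨hd, rfl⟩
    obtain ⟨a, -, g, hg, rfl⟩ := exists_mem_oddParts hm.pos.ne' hd (hA d hd)
    rw [hval hg]
    exact ⟨g, hg, rfl⟩
  · rintro ⟨g, hg, rfl⟩
    exact ⟨(mem_filter.1 hg).2.2, hval hg⟩

theorem dilate_dilate (p q : ℕ) (A : Finset ℕ) : dilate p (dilate q A) = dilate (p * q) A := by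
  simp [dilate, image_image, Function.comp_def, mul_assoc]

theorem dilate_injective {p : ℕ} (hp : 0 < p) : Function.Injective (dilate p) :=
  image_injective fun _ _ h => Nat.eq_of_mul_eq_mul_left hp h

theorem dilate_erase {p : ℕ} (hp : 0 < p) (A : Finset ℕ) (a : ℕ) :
    dilate p (A.erase a) = (dilate p A).erase (p * a) :=
  image_erase (fun _ _ h => Nat.eq_of_mul_eq_mul_left hp h) _ _

theorem dilate_singleton (p a : ℕ) : dilate p {a} = {p * a} :=
  image_singleton _ _

theorem dilate_layerStar_two_pow_mul (hm : Odd m) (hA : ∀ d ∈ A, d ∣ 2 ^ e * m) (a : ℕ) :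
    dilate (2 ^ a) (layerStar (2 ^ e * m) A a) = dilate (2 ^ e) ((oddParts e m A a).erase m) := by
  rw [layerStar, layer_two_pow_mul hm hA]
  obtain ha | ha := le_or_gt a e
  · rw [two_pow_mul_div_two_pow ha, sdiff_singleton_eq_erase,
      ← dilate_erase (by positivity), dilate_dilate, pow_mul_pow_sub 2 ha]
  · simp [oddParts_eq_empty_of_lt ha, dilate]

theorem layer_eq_empty_iff (hm : Odd m) (hA : ∀ d ∈ A, d ∣ 2 ^ e * m) (a : ℕ) :
    layer (2 ^ e * m) A a = ∅ ↔ oddParts e m A a = ∅ := by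
  rw [layer_two_pow_mul hm hA, dilate, image_eq_empty]

theorem two_pow_dvd_two_pow_mul_iff (hm : Odd m) {a : ℕ} : 2 ^ a ∣ 2 ^ e * m ↔ a ≤ e := by
  rw [(hm.coprime_two_left.pow_left a).dvd_mul_right, Nat.pow_dvd_pow_iff_le_right one_lt_two]

theorem dvd_and_layer_eq_singleton_iff (hm : Odd m) (hA : ∀ d ∈ A, d ∣ 2 ^ e * m) (a : ℕ) :
    2 ^ a ∣ 2 ^ e * m ∧ layer (2 ^ e * m) A a = {2 ^ e * m / 2 ^ a} ↔
      oddParts e m A a = {m} := by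
  rw [two_pow_dvd_two_pow_mul_iff hm, layer_two_pow_mul hm hA]
  obtain ha | ha := le_or_gt a e
  · rw [and_iff_right ha, two_pow_mul_div_two_pow ha, ← dilate_singleton,
      (dilate_injective (by positivity)).eq_iff]
  · simp [oddParts_eq_empty_of_lt ha, ha.not_ge, (singleton_ne_empty m).symm]

theorem layerStar_eq_dilate_two_iff (hm : Odd m) (hA : ∀ d ∈ A, d ∣ 2 ^ e * m) (a : ℕ) :
    layerStar (2 ^ e * m) A a = dilate 2 (layerStar (2 ^ e * m) A (a + 1)) ↔
      (oddParts e m A a).erase m = (oddParts e m A (a + 1)).erase m := by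
  rw [← (dilate_injective (p := 2 ^ a) (by positivity)).eq_iff, dilate_dilate, ← pow_succ,
    dilate_layerStar_two_pow_mul hm hA, dilate_layerStar_two_pow_mul hm hA,
    (dilate_injective (by positivity)).eq_iff]

theorem layer_zero_eq_layerStar {n : ℕ} (hA : n ∉ A) : layer n A 0 = layerStar n A 0 := by
  rw [layerStar, pow_zero, Nat.div_one, sdiff_singleton_eq_erase, erase_eq_of_notMem]
  exact fun h => hA (mem_filter.1 h).1

theorem mem_properDivisors_of_mem_oddParts {a g : ℕ} (hg : g ∈ oddParts e m A a) (hgm : g ≠ m) :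
    g ∈ m.properDivisors :=
  have hdiv := (mem_filter.1 hg).1
  Nat.mem_properDivisors.2 ⟨Nat.dvd_of_mem_divisors hdiv, (Nat.divisor_le hdiv).lt_of_ne hgm⟩

theorem oddParts_erase_eq_iff {a a' : ℕ} :
    (oddParts e m A a).erase m = (oddParts e m A a').erase m ↔
      ∀ g ∈ m.properDivisors, g ∈ oddParts e m A a ↔ g ∈ oddParts e m A a' := by
  simp only [Finset.ext_iff, mem_erase, and_congr_right_iff]
  refine ⟨fun h g hg => h g (Nat.mem_properDivisors.1 hg).2.ne, fun h g hgm => ?_⟩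
  exact ⟨fun hg => (h g (mem_properDivisors_of_mem_oddParts hg hgm)).1 hg,
    fun hg => (h g (mem_properDivisors_of_mem_oddParts hg hgm)).2 hg⟩

theorem oddParts_eq_empty_iff {a : ℕ} : oddParts e m A a = ∅ ↔
    m ∉ oddParts e m A a ∧ ∀ g ∈ m.properDivisors, g ∉ oddParts e m A a := by
  refine eq_empty_iff_forall_notMem.trans ⟨fun h => ⟨h m, fun g _ => h g⟩, fun h g hg => ?_⟩
  obtain rfl | hgm := eq_or_ne g m
  · exact h.1 hg
  · exact h.2 g (mem_properDivisors_of_mem_oddParts hg hgm) hg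

theorem oddParts_eq_singleton_iff {a : ℕ} : oddParts e m A a = {m} ↔
    m ∈ oddParts e m A a ∧ ∀ g ∈ m.properDivisors, g ∉ oddParts e m A a := by
  refine eq_singleton_iff_unique_mem.trans (and_congr_right fun _ => ⟨fun h g hg hgA => ?_,
    fun h g hg => ?_⟩)
  · exact (Nat.mem_properDivisors.1 hg).2.ne (h g hgA)
  · by_contra hgm
    exact h g (mem_properDivisors_of_mem_oddParts hg hgm) hg

theorem evenCoeff_eq_zero_iff (hm : m ≠ 0) {a g : ℕ} (hg : g ∣ m) :
    evenCoeff e B a g = 0 ↔ g ∉ oddParts e m B a := by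
  simp [evenCoeff, oddParts, hg, hm]

theorem evenCoeff_eq_one_iff (hm : m ≠ 0) {a g : ℕ} (hg : g ∣ m) :
    evenCoeff e B a g = 1 ↔ g ∈ oddParts e m B a := by
  simp [evenCoeff, oddParts, hg, hm]

theorem evenCoeff_eq_evenCoeff_iff {a a' g : ℕ} (hm : m ≠ 0) (hg : g ∣ m) :
    evenCoeff e B a g = evenCoeff e B a' g ↔ (g ∈ oddParts e m B a ↔ g ∈ oddParts e m B a') := by
  rw [← evenCoeff_eq_one_iff hm hg, ← evenCoeff_eq_one_iff hm hg]
  have := evenCoeff_eq_zero_or_one e B a g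
  have := evenCoeff_eq_zero_or_one e B a' g
  lia

theorem oddCoeff_eq_zero_iff (hm : Odd m) {a g : ℕ} (hg : g ∣ m) :
    oddCoeff e m D σ a g = 0 ↔ g ∉ oddParts e m D a := by
  have hχ : ZMod.χ₄ ((m / g : ℕ) : ZMod 4) ≠ 0 := by
    obtain h | h := χ₄_natCast_of_odd (hm.of_dvd_nat (Nat.div_dvd_of_dvd hg)) <;> rw [h] <;> decide
  rw [← not_iff_not, ← Ne, oddCoeff, ite_ne_right_iff, mul_ne_zero_iff_right hχ, Ne,
    extendedSign_eq_zero_iff, oddParts, mem_filter, Nat.mem_divisors,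
    and_iff_right (And.intro hg hm.pos.ne'), not_not, not_not]

theorem levelCondition_iff_oddParts (hm : Odd m) :
    LevelCondition m (evenCoeff e B) (oddCoeff e m D σ) ↔
      ((oddParts e m B 0).erase m = (oddParts e m B 1).erase m ∧
        (oddParts e m B 1).erase m = (oddParts e m B 2).erase m) ∧
      ((oddParts e m D 2 = {m} ∧ m ∉ oddParts e m B 1) ∨
        (oddParts e m D 2 = ∅ ∧ Xor (m ∈ oddParts e m B 1) (m ∈ oddParts e m B 2)) ∨
        (oddParts e m D 2 = ∅ ∧ (m ∈ oddParts e m B 2 ∧ m ∈ oddParts e m B 1) ∧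
          oddParts e m D 3 = {m} ∧
          (oddParts e m B 2).erase m = (oddParts e m B 3).erase m)) := by
  have hm0 := hm.pos.ne'
  have hdvd {g : ℕ} (hg : g ∈ m.properDivisors) := (Nat.mem_properDivisors.1 hg).1
  have hproper : (∀ g ∈ m.properDivisors, evenCoeff e B 0 g = evenCoeff e B 1 g ∧
      evenCoeff e B 1 g = evenCoeff e B 2 g ∧ oddCoeff e m D σ 2 g = 0) ↔
      ((oddParts e m B 0).erase m = (oddParts e m B 1).erase m ∧
        (oddParts e m B 1).erase m = (oddParts e m B 2).erase m) ∧
      ∀ g ∈ m.properDivisors, g ∉ oddParts e m D 2 := by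
    simp only [oddParts_erase_eq_iff, ← forall₂_and, and_assoc]
    refine forall₂_congr fun g hg => ?_
    rw [evenCoeff_eq_evenCoeff_iff hm0 (hdvd hg), evenCoeff_eq_evenCoeff_iff hm0 (hdvd hg),
      oddCoeff_eq_zero_iff hm (hdvd hg)]
  have hproper' : (∀ g ∈ m.properDivisors, oddCoeff e m D σ 3 g = 0 ∧
      evenCoeff e B 2 g = evenCoeff e B 3 g) ↔
      (∀ g ∈ m.properDivisors, g ∉ oddParts e m D 3) ∧
        (oddParts e m B 2).erase m = (oddParts e m B 3).erase m := by
    simp only [oddParts_erase_eq_iff, ← forall₂_and]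
    refine forall₂_congr fun g hg => ?_
    rw [evenCoeff_eq_evenCoeff_iff hm0 (hdvd hg), oddCoeff_eq_zero_iff hm (hdvd hg)]
  simp only [LevelCondition, hproper, hproper', Ne, evenCoeff_eq_one_iff hm0 dvd_rfl,
    evenCoeff_eq_zero_iff hm0 dvd_rfl, oddCoeff_eq_zero_iff hm dvd_rfl,
    evenCoeff_eq_evenCoeff_iff hm0 dvd_rfl, oddParts_eq_singleton_iff, oddParts_eq_empty_iff,
    xor_iff_not_iff, not_not]
  grind

theorem levelCondition_iff_layer (he : 2 ≤ e) (hm : Odd m)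
    (hB : ∀ d ∈ B, d ∣ 2 ^ e * m) (hnB : 2 ^ e * m ∉ B) (hD : ∀ d ∈ D, d ∣ 2 ^ e * m) :
    LevelCondition m (evenCoeff e B) (oddCoeff e m D σ) ↔
      ((layer (2 ^ e * m) B 0 = dilate 2 (layerStar (2 ^ e * m) B 1) ∧
          dilate 2 (layerStar (2 ^ e * m) B 1) = dilate 4 (layerStar (2 ^ e * m) B 2)) ∧
        ((4 ∣ 2 ^ e * m ∧ layer (2 ^ e * m) D 2 = {2 ^ e * m / 4} ∧ 2 ^ e * m / 2 ∉ B) ∨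
          (4 ∣ 2 ^ e * m ∧ layer (2 ^ e * m) D 2 = ∅ ∧
            Xor (2 ^ e * m / 2 ∈ B) (2 ^ e * m / 4 ∈ B)) ∨
          (8 ∣ 2 ^ e * m ∧ layer (2 ^ e * m) D 2 = ∅ ∧
            (2 ^ e * m / 4 ∈ B ∧ 2 ^ e * m / 2 ∈ B) ∧ layer (2 ^ e * m) D 3 = {2 ^ e * m / 8} ∧
            layerStar (2 ^ e * m) B 2 = dilate 2 (layerStar (2 ^ e * m) B 3)))) := by
  have hfour : 4 ∣ 2 ^ e * m := (pow_dvd_pow 2 he).mul_right m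
  have hhalf : 2 ^ e * m / 2 ∈ B ↔ m ∈ oddParts e m B 1 :=
    (self_mem_oddParts_iff hm.pos.ne' (one_le_two.trans he)).symm
  have hquarter : 2 ^ e * m / 4 ∈ B ↔ m ∈ oddParts e m B 2 :=
    (self_mem_oddParts_iff hm.pos.ne' he).symm
  have htwo : layer (2 ^ e * m) D 2 = {2 ^ e * m / 4} ↔ oddParts e m D 2 = {m} :=
    (and_iff_right hfour).symm.trans (dvd_and_layer_eq_singleton_iff hm hD 2)
  have hthree : 8 ∣ 2 ^ e * m ∧ layer (2 ^ e * m) D 3 = {2 ^ e * m / 8} ↔ oddParts e m D 3 = {m} :=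
    dvd_and_layer_eq_singleton_iff hm hD 3
  rw [levelCondition_iff_oddParts hm, layer_zero_eq_layerStar hnB, ← dilate_dilate 2 2,
    (dilate_injective two_pos).eq_iff, layerStar_eq_dilate_two_iff hm hB,
    layerStar_eq_dilate_two_iff hm hB, layerStar_eq_dilate_two_iff hm hB, hhalf, hquarter,
    and_iff_right hfour, and_iff_right hfour, htwo, layer_eq_empty_iff hm hD,
    and_left_comm (a := 8 ∣ 2 ^ e * m), and_left_comm (a := 8 ∣ 2 ^ e * m),
    ← and_assoc (a := 8 ∣ 2 ^ e * m), hthree]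

theorem eq_singleton_of_levelCondition (hm : Odd m) (hB : ∀ d ∈ B, d ∣ 2 ^ 1 * m)
    (hnB : 2 ^ 1 * m ∉ B) (h : LevelCondition m (evenCoeff 1 B) (oddCoeff 1 m D σ)) : B = {m} := by
  obtain ⟨⟨h01, h12⟩, hm1⟩ := (levelCondition_iff_oddParts hm).1 h
  rw [oddParts_eq_empty_of_lt one_lt_two, erase_empty] at h12
  have hmB : m ∈ B := by
    have : m ∈ oddParts 1 m B 1 := by
      simpa [oddParts_eq_empty_of_lt, (singleton_ne_empty m).symm, xor_iff_not_iff] using hm1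
    simpa using (mem_filter.1 this).2.2
  refine eq_singleton_iff_unique_mem.2 ⟨hmB, fun d hd => ?_⟩
  obtain ⟨a, ha, g, hg, rfl⟩ := exists_mem_oddParts hm.pos.ne' hd (hB d hd)
  have hstar : (oddParts 1 m B a).erase m = ∅ := by
    obtain rfl | rfl := Nat.le_one_iff_eq_zero_or_eq_one.1 ha
    exacts [h01.trans h12, h12]
  obtain rfl : g = m := by
    by_contra hgm
    exact notMem_empty g (hstar ▸ mem_erase.2 ⟨hgm, hg⟩)
  obtain rfl | rfl := Nat.le_one_iff_eq_zero_or_eq_one.1 ha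
  · exact absurd hd hnB
  · exact one_mul g

end OddParts

theorem theorem1p2 (n : ℕ) [NeZero n] (B D : Finset ℕ) (σ : {d // d ∈ D} → ℤˣ)
    (hB : ∀ d ∈ B, d ∣ n ∧ d < n) (hD : ∀ d ∈ D, 4 ∣ n ∧ d ∣ n / 4) (hBD : Disjoint B D)
    (hmatching : ¬ (n % 4 = 2 ∧ B = {n / 2})) :
    (Even n ∧ ∀ b : ZMod n, (imcg n B D σ).HasPST (b + ((n / 2 : ℕ) : ZMod n)) b) ↔
      ((layer n B 0 = dilate 2 (layerStar n B 1) ∧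
          dilate 2 (layerStar n B 1) = dilate 4 (layerStar n B 2)) ∧
        ((4 ∣ n ∧ layer n D 2 = {n / 4} ∧ n / 2 ∉ B) ∨
          (4 ∣ n ∧ layer n D 2 = ∅ ∧ Xor (n / 2 ∈ B) (n / 4 ∈ B)) ∨
          (8 ∣ n ∧ layer n D 2 = ∅ ∧ (n / 4 ∈ B ∧ n / 2 ∈ B) ∧ layer n D 3 = {n / 8} ∧
            layerStar n B 2 = dilate 2 (layerStar n B 3)))) := by
  obtain ⟨e, m, hm, rfl⟩ := Nat.exists_eq_two_pow_mul_odd (NeZero.ne n)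
  have hB' : ∀ d ∈ B, d ∣ 2 ^ e * m := fun d hd => (hB d hd).1
  have hnB : 2 ^ e * m ∉ B := fun h => (hB _ h).2.false
  have hD' : ∀ d ∈ D, 4 * d ∣ 2 ^ e * m := fun d hd =>
    Nat.mul_dvd_of_dvd_div (hD d hd).1 (hD d hd).2
  have hPST (he : e ≠ 0) := forall_hasPST_imcg_iff (σ := σ) he hm hnB hD' hBD
  by_cases he : 2 ≤ e
  · have hn : Even (2 ^ e * m) := ((Nat.even_pow' (by lia)).2 even_two).mul_right m
    rw [and_iff_right hn, hPST (by lia), levelCondition_iff_layer he hm hB' hnB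
      fun d hd => (Nat.dvd_mul_left d 4).trans (hD' d hd)]
  · have hfour : ¬ 4 ∣ 2 ^ e * m := fun h => he ((two_pow_dvd_two_pow_mul_iff (a := 2) hm).1 h)
    refine iff_of_false (fun ⟨hn, h⟩ => ?_) fun h => ?_
    · obtain rfl : e = 1 := by
        have : e ≠ 0 := by
          rintro rfl
          exact Nat.not_even_iff_odd.2 hm (by simpa using hn)
        lia
      have hBm := eq_singleton_of_levelCondition hm hB' hnB ((hPST one_ne_zero).1 h)
      have := Nat.odd_iff.1 hm
      exact hmatching ⟨by lia, by rw [hBm, pow_one, Nat.mul_div_cancel_left m two_pos]⟩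
    · obtain h | h | h := h.2
      exacts [hfour h.1, hfour h.1, hfour (dvd_trans (by norm_num) h.1)]
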